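/- Let $\Gamma$ be the fundamental group of a closed orientable surface of genus at least $2$, let $\iota:\Gamma\to H=\mathrm{SL}(2,\mathbb R)$ be an injective morphism with discrete image, and let $\Phi^t$ be the flow on $M=\iota(\Gamma)\backslash H$ induced by right multiplication by $a^t=\mathrm{diag}(e^t,e^{-t})$. Let $V=\mathbb R^3$ and $G=\mathrm{SL}(V)\cong\mathrm{PGL}(3,\mathbb R)$. Let $X\subset P(V)\times P(V^*)$ be the flag variety, i.e. the set of pairs $([u],[u^*])$ with $\langle u\mid u^*\rangle=0$, and let $Y$ be the frame variety, i.e. the set of triples $([u],[v],[w])$ of noncollinear points of $P(V)$. Write $[(uv)^*]\in P(V^*)$ for the projective line through $[u]\ne[v]$, and set $\pi_+([u],[v],[w])=([u],[(uv)^*])$ and $\pi_-([u],[v],[w])=([w],[(wv)^*])$; let $E^\pm\subset TY$ be the tangent bundle to the fibres of $\pi_\pm:Y\to X$. For a representation $\rho:\Gamma\to G$ let $E_\rho\to M$ be the flat bundle $\Gamma\backslash(H\times Y)$, where $\gamma(h,y)=(\iota(\gamma)h,\rho(\gamma)y)$, with the horizontal flow $\Phi^t_\rho$ induced by $(h,y)\mapsto(ha^t,y)$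 and the vertical subbundles $E^\pm_\rho$ induced by $E^\pm$. The representation $\rho$ is $(G,Y)$-Anosov if $E_\rho\to M$ has a continuous section $s$ whose image $S$ is $\Phi^t_\rho$-invariant and such that, for every continuous norm $\Vert\cdot\Vert$ on the vertical tangent bundle of $E_\rho$, there are constants $a,b>0$ with $$\Vert D_p\Phi^t_\rho(v^+)\Vert\le be^{-at}\Vert v^+\Vert,\qquad \Vert D_p\Phi^{-t}_\rho(v^-)\Vert\le be^{-at}\Vert v^-\Vert$$ for all $p\in S$, all $t>0$ and all vectors $v^\pm\in E^\pm_\rho$ over $p$. The section $s$ lifts to a continuous $\Gamma$-equivariant map $f:H\to Y$ with $f(ha^t)=f(h)$. Let $\Lambda=\pi_+(f(H))\subset X$ be the limit curve, let $L\subset P(V)$ and $L^*\subset P(V^*)$ be its two projections, and let $\Omega$ be the set of flags $([u],[u^*])\in X$ with $[u]\notin L$ and $[u^*]\notin L^*$. **Theorem.** For every $(G,Y)$-Anosov representation $\rho:\Gamma\to G$ (and every section $s$ as above), $\Omega$ is open and $\rho(\Gamma)$-invariant, and the action of $\Gamma$ on $\Omega$ through $\rho$ is free (if $\rho(\gamma)x=x$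 for some $x\in\Omega$, then $\gamma=1$) and properly discontinuous (for all compact $K,K'\subset\Omega$, the set of $\gamma\in\Gamma$ with $\rho(\gamma)K\cap K'\ne\emptyset$ is finite). -/

import Mathlib

open scoped LinearAlgebra.Projectivization MatrixGroups

noncomputable section

namespace AnosovFlag

/-! ### Surface groups -/

/-- The relator `[a₁, b₁] ⋯ [a_g, b_g]` in the free group on `a₁, …, a_g, b₁, …, b_g`
(`Sum.inl` indexes the `aⱼ`, `Sum.inr` the `bⱼ`). -/
def surfaceRelator (g : ℕ) : FreeGroup (Fin g ⊕ Fin g) :=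
  (List.ofFn fun j : Fin g =>
    FreeGroup.of (Sum.inl j) * FreeGroup.of (Sum.inr j) *
      (FreeGroup.of (Sum.inl j))⁻¹ * (FreeGroup.of (Sum.inr j))⁻¹).prod

/-- The fundamental group of the closed orientable surface of genus `g`. -/
abbrev SurfaceGroup (g : ℕ) : Type := PresentedGroup {surfaceRelator g}

/-- `Γ` is the fundamental group of a closed orientable surface of negative Euler
characteristic, i.e. of genus at least two. -/
def IsHyperbolicSurfaceGroup (Γ : Type*) [Group Γ] : Prop :=
  ∃ g : ℕ, 2 ≤ g ∧ Nonempty (Γ ≃* SurfaceGroup g)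

/-! ### The flag variety -/

/-- The projective plane `P(V)`, `V = ℝ³`. The dual plane `P(V*)` is also written `P2`, in the
coordinates of the dual basis: the pairing of `V` with `V*` is then the dot product. -/
abbrev P2 : Type := ℙ ℝ (Fin 3 → ℝ)

/-- The quotient topology of the projective plane. -/
instance instTopologicalSpaceP2 : TopologicalSpace P2 :=
  TopologicalSpace.coinduced (Projectivization.mk' ℝ) inferInstance

/-- The dual action on `V*`: in coordinates, `g*` is the inverse of the transpose of `g`. -/
def dual (g : SL(3, ℝ)) : SL(3, ℝ) := (g⁻¹).transpose

theorem dual_one : dual 1 = 1 := by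
  apply Subtype.ext
  change ((1 : SL(3, ℝ))⁻¹).1.transpose = 1
  simp

theorem dual_mul (g h : SL(3, ℝ)) : dual (g * h) = dual g * dual h := by
  apply Subtype.ext
  change ((g * h)⁻¹).1.transpose = (g⁻¹).1.transpose * (h⁻¹).1.transpose
  rw [mul_inv_rev, ← Matrix.transpose_mul]
  rfl

theorem orthogonal_smul (g : SL(3, ℝ)) (p q : P2) (h : p.orthogonal q) :
    (g • p).orthogonal (dual g • q) := by
  induction p using Projectivization.ind with | _ v hv =>
  induction q using Projectivization.ind with | _ w hw =>
  rw [Projectivization.orthogonal_mk hv hw] at h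
  rw [Projectivization.smul_mk, Projectivization.smul_mk, Projectivization.orthogonal_mk]
  change (g.1.mulVec v) ⬝ᵥ ((g⁻¹).1.transpose.mulVec w) = 0
  have hg : (g⁻¹).1 * g.1 = 1 := congrArg Subtype.val (inv_mul_cancel g)
  rw [Matrix.mulVec_transpose, dotProduct_comm, ← Matrix.dotProduct_mulVec, Matrix.mulVec_mulVec,
    hg, Matrix.one_mulVec, dotProduct_comm, h]

/-- The flag variety `X`: pairs `([u], [u*])` in `P(V) × P(V*)` with `⟨u | u*⟩ = 0`. -/
def Flag : Type := {F : P2 × P2 // F.1.orthogonal F.2}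

instance : TopologicalSpace Flag := instTopologicalSpaceSubtype

/-- The point `[u]` of a flag `([u], [u*])`. -/
def Flag.pt (F : Flag) : P2 := F.1.1

/-- The line `[u*]` of a flag `([u], [u*])`. -/
def Flag.line (F : Flag) : P2 := F.1.2

instance : MulAction SL(3, ℝ) Flag where
  smul g F := ⟨(g • F.1.1, dual g • F.1.2), orthogonal_smul g _ _ F.2⟩
  one_smul F := Subtype.ext <| Prod.ext (one_smul _ F.1.1) <| by
    change dual 1 • F.1.2 = F.1.2
    rw [dual_one, one_smul]
  mul_smul g h F := Subtype.ext <| Prod.ext (mul_smul g h F.1.1) <| by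
    change dual (g * h) • F.1.2 = dual g • dual h • F.1.2
    rw [dual_mul, mul_smul]

/-! ### The frame variety -/

theorem independent_smul (g : SL(3, ℝ)) (p : Fin 3 → P2) (h : Projectivization.Independent p) :
    Projectivization.Independent (fun j => g • p j) := by
  cases h with | mk f hf hl =>
  have hinj : LinearMap.ker (DistribSMul.toLinearMap ℝ (Fin 3 → ℝ) g) = ⊥ :=
    LinearMap.ker_eq_bot.2 (MulAction.injective g)
  exact Projectivization.Independent.mk (fun j => g • f j)
    (fun j => (smul_ne_zero_iff_ne g).2 (hf j)) (hl.map' _ hinj)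

/-- The frame variety `Y`: triples `([u], [v], [w])` of noncollinear points of `P(V)`
(`u`, `v`, `w` have the indices `0`, `1`, `2`). -/
def Frame : Type := {y : Fin 3 → P2 // Projectivization.Independent y}

instance : TopologicalSpace Frame := instTopologicalSpaceSubtype

instance : MulAction SL(3, ℝ) Frame where
  smul g y := ⟨fun j => g • y.1 j, independent_smul g _ y.2⟩
  one_smul y := Subtype.ext <| funext fun j => one_smul _ (y.1 j)
  mul_smul g h y := Subtype.ext <| funext fun j => mul_smul g h (y.1 j)

theorem Frame.injective (y : Frame) : Function.Injective y.1 := by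
  intro j k hjk
  exact (Projectivization.independent_iff.1 y.2).injective (congrArg Projectivization.rep hjk)

open Classical in
/-- The flag `([u], [(uv)*])` of two distinct points; in coordinates `(uv)*` is spanned by the
cross product of `u` and `v`. -/
def flagOf (p q : P2) (h : p ≠ q) : Flag :=
  ⟨(p, p.cross q), Projectivization.orthogonal_cross_left h⟩

/-- The projection `π₊ ([u], [v], [w]) = ([u], [(uv)*])`. -/
def piPlus (y : Frame) : Flag := flagOf (y.1 0) (y.1 1) (y.injective.ne (by decide))

/-- The projection `π₋ ([u], [v], [w]) = ([w], [(wv)*])`. -/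
def piMinus (y : Frame) : Flag := flagOf (y.1 2) (y.1 1) (y.injective.ne (by decide))

/-! ### Tangent vectors of the frame variety

`Y` is a homogeneous space of `GL(V)`, so the map sending `A ∈ gl(V)` to the velocity at `s = 0` of
`s ↦ exp(sA) y` identifies `T_y Y` with the quotient of `gl(V)` by the stabilizer subalgebra of `y`.
Tangent vectors at `y` are given by matrices `A` through this identification; `A` represents `0`
if and only if it preserves the three lines of the frame. The differential of `y ↦ g y` is
represented by `A ↦ g A g⁻¹`. -/

/-- `gl(V)`. -/
abbrev Mat3 : Type := Matrix (Fin 3) (Fin 3) ℝ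

/-- The matrix `A` maps the line `p` of `ℝ³` into itself. -/
def PreservesLine (A : Mat3) (p : P2) : Prop := ∀ v ∈ p.submodule, A.mulVec v ∈ p.submodule

/-- `A` belongs to the stabilizer subalgebra of the frame `y`. -/
def FixesFrame (A : Mat3) (y : Frame) : Prop := ∀ j, PreservesLine A (y.1 j)

/-- `A` belongs to the stabilizer subalgebra of the flag `F` (its infinitesimal action on `V*` is
`-Aᵀ`). For `F = π₊ y`, this says that the tangent vector at `y` represented by `A` is tangent to
the fibre of `π₊`, that is, lies in `E⁺`; likewise for `π₋` and `E⁻`. -/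
def FixesFlag (A : Mat3) (F : Flag) : Prop :=
  PreservesLine A F.pt ∧ PreservesLine A.transpose F.line

/-! ### Anosov structures -/

/-- The one-parameter subgroup `aᵗ = diag(eᵗ, e⁻ᵗ)` of `SL(2, ℝ)`. -/
def diagFlow (t : ℝ) : SL(2, ℝ) :=
  ⟨!![Real.exp t, 0; 0, Real.exp (-t)], by
    rw [Matrix.det_fin_two_of, ← Real.exp_add]; simp⟩

variable {Γ : Type*} [Group Γ]

/-- A continuous norm on the vertical tangent bundle of the flat bundle `E_ρ = Γ \ (H × Y)` over
`M = ι(Γ) \ H`, `H = SL(2, ℝ)`, with `γ (h, y) = (ι(γ) h, ρ(γ) y)`: a `Γ`-invariant family of norms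
on the spaces `T_y Y`, depending continuously on `(h, y)`. A norm on `T_y Y` is a seminorm on
`gl(V)` whose null space is the stabilizer subalgebra of `y`. -/
structure VerticalNorm (ι : Γ →* SL(2, ℝ)) (ρ : Γ →* SL(3, ℝ)) where
  /-- The norm over the point `(h, y)`. -/
  norm : SL(2, ℝ) → Frame → Seminorm ℝ Mat3
  norm_eq_zero_iff : ∀ h y A, norm h y A = 0 ↔ FixesFrame A y
  continuous_norm : Continuous fun q : SL(2, ℝ) × Frame × Mat3 => norm q.1 q.2.1 q.2.2
  norm_smul : ∀ (γ : Γ) h y (A : Mat3),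
    norm (ι γ * h) (ρ γ • y) ((ρ γ : Mat3) * A * ((ρ γ)⁻¹ : SL(3, ℝ))) = norm h y A

/-- A `(G, Y)`-Anosov structure over `(M, Φᵗ)`, where `Φᵗ` is induced by `h ↦ h aᵗ`. The section `s`
of `E_ρ → M` is given by its lift `f : H → Y`, and the horizontal flow is `(h, y) ↦ (h aᵗ, y)`. -/
structure IsAnosovStructure (ι : Γ →* SL(2, ℝ)) (ρ : Γ →* SL(3, ℝ)) (f : SL(2, ℝ) → Frame) :
    Prop where
  continuous : Continuous f
  equivariant : ∀ (γ : Γ) h, f (ι γ * h) = ρ γ • f h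
  flow_invariant : ∀ h t, f (h * diagFlow t) = f h
  hyperbolic : ∀ N : VerticalNorm ι ρ, ∃ a b : ℝ, 0 < a ∧ 0 < b ∧
    ∀ (h : SL(2, ℝ)) (t : ℝ), 0 < t → ∀ A : Mat3,
      (FixesFlag A (piPlus (f h)) →
        N.norm (h * diagFlow t) (f h) A ≤ b * Real.exp (-a * t) * N.norm h (f h) A) ∧
      (FixesFlag A (piMinus (f h)) →
        N.norm (h * diagFlow (-t)) (f h) A ≤ b * Real.exp (-a * t) * N.norm h (f h) A)

/-! ### The limit curves and the domain `Ω` -/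

/-- The limit curve `Λ ⊆ X`, the image of `π₊ ∘ f`. -/
def limitCurve (f : SL(2, ℝ) → Frame) : Set Flag := Set.range fun h => piPlus (f h)

/-- The curve `L ⊆ P(V)`. -/
def curveL (f : SL(2, ℝ) → Frame) : Set P2 := Flag.pt '' limitCurve f

/-- The curve `L* ⊆ P(V*)`. -/
def curveLDual (f : SL(2, ℝ) → Frame) : Set P2 := Flag.line '' limitCurve f

/-- The set `Ω` of flags `([u], [u*])` with `[u] ∉ L` and `[u*] ∉ L*`. -/
def domainOmega (f : SL(2, ℝ) → Frame) : Set Flag :=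
  {F | F.pt ∉ curveL f ∧ F.line ∉ curveLDual f}

end AnosovFlag

end

/-!
Averaging over `Γ` yields a vertical norm, so the contraction of `E⁺` is available. If
`ι(Γ) \ SL(2, ℝ)` were not compact, it would contain a flow ray escaping to infinity, and the
contraction would fail along this ray for a norm that grows fast enough at infinity; hence the
quotient is compact.

If `ι(γᵢ) cᵢ = hᵢ a^{tᵢ}` with `tᵢ → ∞`, `cᵢ → c`, `hᵢ → h`, then `ρ(γᵢ)` is diagonal from the frame
`f(cᵢ)` to the frame `f(hᵢ)`. The ratios of its diagonal entries are the factors by which it scales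
the root vectors, so by the contraction `ρ(γᵢ)` attracts flags transverse to `π₋(f(c))` to
`π₊(f(h))`. An attracting flag is unique. By cocompactness this shows that `π₊ ∘ f` is invariant
under right multiplication by upper triangular matrices, so `Λ` is the image of `SO(2)` and hence
compact, and that `π₋(f(c))` belongs to `Λ` too. By the Cartan decomposition every sequence of
distinct elements of `Γ` has such dynamics along an ultrafilter, with both flags in `Λ`, which
yields proper discontinuity on `Ω`. Stabilizers are then finite, and surface groups are
torsion-free.
-/

noncomputable section

namespace AnosovFlag

open Filter Topology
open scoped Matrix

/-! ### Surface groups are torsion-free -/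

section Torsion

open SemidirectProduct

theorem eq_one_of_isOfFinOrder_semidirectProduct {N G : Type*} [Group N] [Group G]
    {φ : G →* MulAut N} (hN : ∀ x : N, IsOfFinOrder x → x = 1)
    (hG : ∀ x : G, IsOfFinOrder x → x = 1) (x : N ⋊[φ] G) (hx : IsOfFinOrder x) : x = 1 := by
  have hright : x.right = 1 := hG _ (rightHom.isOfFinOrder hx)
  obtain ⟨n, rfl⟩ : x ∈ (inl : N →* N ⋊[φ] G).range := by
    rwa [range_inl_eq_ker_rightHom, MonoidHom.mem_ker]
  rw [hN n ((inl_injective.isOfFinOrder_iff (f := inl)).1 hx), map_one]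

variable {n : ℕ}

theorem surfaceRelator_succ :
    surfaceRelator (n + 1) = FreeGroup.of (Sum.inl 0) * FreeGroup.of (Sum.inr 0) *
      (FreeGroup.of (Sum.inl 0))⁻¹ * (FreeGroup.of (Sum.inr 0))⁻¹ *
        FreeGroup.map (Sum.map Fin.succ Fin.succ) (surfaceRelator n) := by
  simp [surfaceRelator, List.ofFn_succ, map_list_prod, List.map_ofFn, Function.comp_def]

/-- Free generators of the kernel of the homomorphism from the surface group of genus `n + 1` to `ℤ`
that counts `a₁`: `none` stands for `b₁` and `some (x, k)` for `a₁ᵏ x a₁⁻ᵏ`, where `x` is one of the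
other `2n` generators. -/
abbrev CyclicCoverGen (n : ℕ) : Type := Option ((Fin n ⊕ Fin n) × ℤ)

/-- The surface relator of genus `n` in the generators of level `k`. -/
def levelRelator (n : ℕ) (k : ℤ) : FreeGroup (CyclicCoverGen n) :=
  FreeGroup.map (fun x => some (x, k)) (surfaceRelator n)

/-- Conjugation by `a₁` on the kernel. It maps `b₁` to `r₀⁻¹ b₁`, where `r₀` is the relator of level
`0`, since the surface relator is `a₁ b₁ a₁⁻¹ b₁⁻¹ r₀`. -/
def deckHom (n : ℕ) : FreeGroup (CyclicCoverGen n) →* FreeGroup (CyclicCoverGen n) :=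
  FreeGroup.lift fun
    | none => (levelRelator n 0)⁻¹ * FreeGroup.of none
    | some (x, k) => FreeGroup.of (some (x, k + 1))

/-- Conjugation by `a₁⁻¹` on the kernel. -/
def deckInvHom (n : ℕ) : FreeGroup (CyclicCoverGen n) →* FreeGroup (CyclicCoverGen n) :=
  FreeGroup.lift fun
    | none => levelRelator n (-1) * FreeGroup.of none
    | some (x, k) => FreeGroup.of (some (x, k - 1))

theorem deckHom_levelRelator (k : ℤ) : deckHom n (levelRelator n k) = levelRelator n (k + 1) := by
  rw [levelRelator, ← MonoidHom.comp_apply]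
  exact DFunLike.congr_fun (by ext; simp [deckHom]) (surfaceRelator n)

theorem deckInvHom_levelRelator (k : ℤ) :
    deckInvHom n (levelRelator n k) = levelRelator n (k - 1) := by
  rw [levelRelator, ← MonoidHom.comp_apply]
  exact DFunLike.congr_fun (by ext; simp [deckInvHom]) (surfaceRelator n)

theorem deckHom_none :
    deckHom n (FreeGroup.of none) = (levelRelator n 0)⁻¹ * FreeGroup.of none := by
  simp [deckHom]

theorem deckInvHom_none :
    deckInvHom n (FreeGroup.of none) = levelRelator n (-1) * FreeGroup.of none := by
  simp [deckInvHom]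

/-- Conjugation by `a₁` as an automorphism of the kernel. -/
def deckAut (n : ℕ) : MulAut (FreeGroup (CyclicCoverGen n)) :=
  MonoidHom.toMulEquiv (deckHom n) (deckInvHom n)
    (by
      ext (_ | ⟨x, k⟩)
      · simp [deckHom_none, deckInvHom_none, deckInvHom_levelRelator]
      · simp [deckHom, deckInvHom])
    (by
      ext (_ | ⟨x, k⟩)
      · simp [deckHom_none, deckInvHom_none, deckHom_levelRelator]
      · simp [deckHom, deckInvHom])

theorem deckAut_apply (x : FreeGroup (CyclicCoverGen n)) : deckAut n x = deckHom n x := rfl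

/-- The extension of `ℤ`, generated by `a₁`, by the kernel. -/
abbrev CyclicExtension (n : ℕ) : Type :=
  FreeGroup (CyclicCoverGen n) ⋊[zpowersHom _ (deckAut n)] Multiplicative ℤ

/-- The generators of the surface group of genus `n + 1` in `CyclicExtension n`. -/
def extensionGen (n : ℕ) : Fin (n + 1) ⊕ Fin (n + 1) → CyclicExtension n
  | Sum.inl j => Fin.cases (inr (Multiplicative.ofAdd 1))
      (fun i => inl (FreeGroup.of (some (Sum.inl i, 0)))) j
  | Sum.inr j => Fin.cases (inl (FreeGroup.of none))
      (fun i => inl (FreeGroup.of (some (Sum.inr i, 0)))) j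

theorem lift_extensionGen_surfaceRelator :
    FreeGroup.lift (extensionGen n) (surfaceRelator (n + 1)) = 1 := by
  have hconj : (inr (Multiplicative.ofAdd 1) : CyclicExtension n) * inl (FreeGroup.of none) *
      (inr (Multiplicative.ofAdd 1))⁻¹ = inl ((levelRelator n 0)⁻¹ * FreeGroup.of none) := by
    rw [← deckHom_none, ← deckAut_apply, ← map_inv, ← inl_aut]
    simp
  have hlevel : (FreeGroup.lift (extensionGen n)).comp (FreeGroup.map (Sum.map Fin.succ Fin.succ)) =
      inl.comp (FreeGroup.map fun x => some (x, 0)) := by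
    ext (x | x) <;> simp [extensionGen]
  rw [surfaceRelator_succ, map_mul, ← MonoidHom.comp_apply, hlevel]
  simp only [map_mul, map_inv, FreeGroup.lift_apply_of, extensionGen, Fin.cases_zero]
  rw [hconj]
  simp [levelRelator]

/-- The homomorphism from the surface group of genus `n + 1` to `CyclicExtension n`. -/
def toCyclicExtension (n : ℕ) : SurfaceGroup (n + 1) →* CyclicExtension n :=
  PresentedGroup.toGroup (f := extensionGen n) (by
    rintro _ rfl
    exact lift_extensionGen_surfaceRelator)

/-- The generators of the kernel in the surface group of genus `n + 1`. -/
def kernelGen (n : ℕ) : CyclicCoverGen n → SurfaceGroup (n + 1)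
  | none => PresentedGroup.of (Sum.inr 0)
  | some (x, k) => PresentedGroup.of (Sum.inl 0) ^ k *
      PresentedGroup.of (Sum.map Fin.succ Fin.succ x) * (PresentedGroup.of (Sum.inl 0) ^ k)⁻¹

theorem commutator_mul_levelRelator :
    (PresentedGroup.of (Sum.inl 0) * PresentedGroup.of (Sum.inr 0) *
      (PresentedGroup.of (Sum.inl 0))⁻¹ * (PresentedGroup.of (Sum.inr 0))⁻¹ *
      FreeGroup.lift (kernelGen n) (levelRelator n 0) : SurfaceGroup (n + 1)) = 1 := by
  have hlevel : (FreeGroup.lift (kernelGen n)).comp (FreeGroup.map fun x => some (x, 0)) =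
      (PresentedGroup.mk {surfaceRelator (n + 1)}).comp
        (FreeGroup.map (Sum.map Fin.succ Fin.succ)) := by
    ext x
    simp [kernelGen, PresentedGroup.of]
  have hrel : PresentedGroup.mk {surfaceRelator (n + 1)} (surfaceRelator (n + 1)) = 1 :=
    PresentedGroup.one_of_mem rfl
  rw [levelRelator, ← MonoidHom.comp_apply, hlevel]
  refine Eq.trans ?_ ((congrArg (PresentedGroup.mk _) surfaceRelator_succ).symm.trans hrel)
  simp [PresentedGroup.of]

theorem lift_kernelGen_deckHom (x : FreeGroup (CyclicCoverGen n)) :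
    FreeGroup.lift (kernelGen n) (deckHom n x) = PresentedGroup.of (Sum.inl 0) *
      FreeGroup.lift (kernelGen n) x * (PresentedGroup.of (Sum.inl 0))⁻¹ := by
  suffices h : (FreeGroup.lift (kernelGen n)).comp (deckHom n) =
      (MulAut.conj (PresentedGroup.of (Sum.inl 0))).toMonoidHom.comp
        (FreeGroup.lift (kernelGen n)) from DFunLike.congr_fun h x
  ext (_ | ⟨x, k⟩)
  · simp only [MonoidHom.comp_apply, deckHom_none, map_mul, map_inv, FreeGroup.lift_apply_of]
    rw [← mul_eq_one_iff_eq_inv.1 commutator_mul_levelRelator]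
    simp [kernelGen]
  · simp only [MonoidHom.comp_apply, deckHom, FreeGroup.lift_apply_of, kernelGen,
      MulEquiv.toMonoidHom_eq_coe, MonoidHom.coe_coe, MulAut.conj_apply]
    group

theorem lift_kernelGen_deckAut_zpow (k : ℤ) (x : FreeGroup (CyclicCoverGen n)) :
    FreeGroup.lift (kernelGen n) ((deckAut n ^ k) x) = PresentedGroup.of (Sum.inl 0) ^ k *
      FreeGroup.lift (kernelGen n) x * (PresentedGroup.of (Sum.inl 0) ^ k)⁻¹ := by
  induction k generalizing x with
  | zero => simp
  | succ k ih =>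
    rw [zpow_add_one, MulAut.mul_apply, ih, deckAut_apply, lift_kernelGen_deckHom]
    group
  | pred k ih =>
    obtain ⟨z, rfl⟩ := (deckAut n).surjective x
    rw [zpow_sub_one, MulAut.mul_apply, MulAut.inv_apply_self, ih, deckAut_apply,
      lift_kernelGen_deckHom]
    group

/-- The homomorphism from `CyclicExtension n` to the surface group of genus `n + 1`. -/
def ofCyclicExtension (n : ℕ) : CyclicExtension n →* SurfaceGroup (n + 1) :=
  SemidirectProduct.lift (FreeGroup.lift (kernelGen n))
    (zpowersHom _ (PresentedGroup.of (Sum.inl 0))) fun g =>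
      MonoidHom.ext fun x => lift_kernelGen_deckAut_zpow g.toAdd x

theorem toCyclicExtension_injective : Function.Injective (toCyclicExtension n) := by
  have h : (ofCyclicExtension n).comp (toCyclicExtension n) = MonoidHom.id _ := by
    ext (j | j) <;> refine Fin.cases ?_ (fun i => ?_) j <;>
      simp [toCyclicExtension, extensionGen, ofCyclicExtension, kernelGen]
  exact Function.LeftInverse.injective (g := ofCyclicExtension n) (DFunLike.congr_fun h)

theorem IsHyperbolicSurfaceGroup.eq_one_of_isOfFinOrder {Γ : Type*} [Group Γ]
    (hΓ : IsHyperbolicSurfaceGroup Γ) {γ : Γ} (hγ : IsOfFinOrder γ) : γ = 1 := by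
  obtain ⟨g, hg, ⟨e⟩⟩ := hΓ
  obtain ⟨n, rfl⟩ : ∃ n, g = n + 1 := ⟨g - 1, by lia⟩
  let φ : Γ →* CyclicExtension n := (toCyclicExtension n).comp e.toMonoidHom
  have hφ : Function.Injective φ := toCyclicExtension_injective.comp e.injective
  exact hφ ((eq_one_of_isOfFinOrder_semidirectProduct (fun _ => IsOfFinOrder.eq_one')
    (fun _ => IsOfFinOrder.eq_one') _ (φ.isOfFinOrder hγ)).trans (map_one φ).symm)

end Torsion

/-! ### Homogeneous coordinates -/

section Coordinates

section Represents

variable {K V : Type*} [DivisionRing K] [AddCommGroup V] [Module K V] {u v : V} {p : ℙ K V}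

/-- `u` is a vector of homogeneous coordinates of the point `p`: it is nonzero and spans `p`. -/
def Represents (u : V) (p : ℙ K V) : Prop := ∃ hu : u ≠ 0, Projectivization.mk K u hu = p

theorem represents_rep (p : ℙ K V) : Represents p.rep p := ⟨p.rep_nonzero, p.mk_rep⟩

theorem Represents.exists_eq_smul (hu : Represents u p) (hv : Represents v p) :
    ∃ d : K, d ≠ 0 ∧ v = d • u := by
  obtain ⟨hu, rfl⟩ := hu
  obtain ⟨hv, h⟩ := hv
  obtain ⟨d, hd⟩ := (Projectivization.mk_eq_mk_iff K v u hv hu).1 h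
  exact ⟨d, d.ne_zero, hd.symm⟩

theorem Represents.smul (hu : Represents u p) {d : K} (hd : d ≠ 0) : Represents (d • u) p := by
  obtain ⟨hu, rfl⟩ := hu
  exact ⟨smul_ne_zero hd hu, (Projectivization.mk_eq_mk_iff' K _ _ _ _).2 ⟨d, rfl⟩⟩

theorem Represents.mem_submodule_iff (hu : Represents u p) :
    v ∈ p.submodule ↔ ∃ c : K, c • u = v := by
  obtain ⟨hu, rfl⟩ := hu
  rw [Projectivization.submodule_mk, Submodule.mem_span_singleton]

end Represents

section Matrix

variable {F n : Type*} [Field F] [Fintype n] {u v : n → F} {p q : ℙ F (n → F)}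

theorem Represents.mulVec [DecidableEq n] (hu : Represents u p)
    (g : Matrix.SpecialLinearGroup n F) : Represents (g.1 *ᵥ u) (g • p) := by
  obtain ⟨hu, rfl⟩ := hu
  rw [Projectivization.smul_mk]
  exact ⟨_, rfl⟩

theorem Represents.orthogonal_iff (hu : Represents u p) (hv : Represents v q) :
    p.orthogonal q ↔ u ⬝ᵥ v = 0 := by
  obtain ⟨hu, rfl⟩ := hu
  obtain ⟨hv, rfl⟩ := hv
  exact Projectivization.orthogonal_mk hu hv

end Matrix

theorem Represents.preservesLine_iff {u : Fin 3 → ℝ} {p : P2} (hu : Represents u p) (A : Mat3) :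
    PreservesLine A p ↔ ∃ c : ℝ, c • u = A *ᵥ u := by
  simp only [PreservesLine, hu.mem_submodule_iff]
  refine ⟨fun h => h u ⟨1, one_smul ℝ u⟩, ?_⟩
  rintro ⟨c, hc⟩ _ ⟨d, rfl⟩
  exact ⟨d * c, by rw [Matrix.mulVec_smul, ← hc, mul_smul]⟩

theorem exists_not_orthogonal_pair (p q : P2) : ∃ z : P2, ¬ z.orthogonal p ∧ ¬ z.orthogonal q := by
  suffices ∃ v : Fin 3 → ℝ, v ⬝ᵥ p.rep ≠ 0 ∧ v ⬝ᵥ q.rep ≠ 0 by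
    obtain ⟨v, hp, hq⟩ := this
    have hv : Represents v (Projectivization.mk ℝ v fun h => hp (by simp [h])) := ⟨_, rfl⟩
    exact ⟨_, mt (hv.orthogonal_iff (represents_rep p)).1 hp,
      mt (hv.orthogonal_iff (represents_rep q)).1 hq⟩
  have hp : p.rep ⬝ᵥ p.rep ≠ 0 := by simpa using p.rep_nonzero
  have hq : q.rep ⬝ᵥ q.rep ≠ 0 := by simpa using q.rep_nonzero
  by_cases h : p.rep ⬝ᵥ q.rep = 0
  · refine ⟨p.rep + q.rep, ?_, ?_⟩
    · rwa [add_dotProduct, dotProduct_comm q.rep, h, add_zero]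
    · rwa [add_dotProduct, h, zero_add]
  · exact ⟨p.rep, hp, h⟩

theorem isOpenQuotientMap_mk' :
    IsOpenQuotientMap (Projectivization.mk' ℝ : {v : Fin 3 → ℝ // v ≠ 0} → P2) where
  surjective p := ⟨⟨p.rep, p.rep_nonzero⟩, p.mk_rep⟩
  continuous := continuous_coinduced_rng
  isOpenMap U hU := by
    have hscale (c : ℝˣ) : Continuous fun v : {v : Fin 3 → ℝ // v ≠ 0} =>
        (⟨c • v.1, (smul_ne_zero_iff_ne c).2 v.2⟩ : {v : Fin 3 → ℝ // v ≠ 0}) :=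
      (continuous_subtype_val.const_smul c).subtype_mk _
    change IsOpen (Projectivization.mk' ℝ ⁻¹' (Projectivization.mk' ℝ '' U))
    convert isOpen_iUnion fun c : ℝˣ => hU.preimage (hscale c)
    ext v
    simp only [Set.mem_preimage, Set.mem_image, Set.mem_iUnion]
    constructor
    · rintro ⟨w, hw, h⟩
      obtain ⟨c, hc⟩ := (Projectivization.mk_eq_mk_iff ℝ w.1 v.1 w.2 v.2).1 h
      exact ⟨c, by rwa [show (⟨c • v.1, _⟩ : {v : Fin 3 → ℝ // v ≠ 0}) = w from Subtype.ext hc]⟩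
    · rintro ⟨c, hc⟩
      exact ⟨_, hc, (Projectivization.mk_eq_mk_iff ℝ _ v.1 _ v.2).2 ⟨c, rfl⟩⟩

instance : T2Space P2 := by
  refine (t2Space_iff_of_isOpenQuotientMap isOpenQuotientMap_mk').2 ?_
  have hcross : Continuous fun w : (Fin 3 → ℝ) × (Fin 3 → ℝ) => w.1 ⨯₃ w.2 := by
    simp only [cross_apply]
    exact Continuous.matrixVecCons (by fun_prop) <|
      Continuous.matrixVecCons (by fun_prop) <| Continuous.matrixVecCons (by fun_prop) <|
        continuous_const
  convert isClosed_singleton (x := (0 : Fin 3 → ℝ)) |>.preimage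
    (hcross.comp (continuous_subtype_val.prodMap continuous_subtype_val))
  ext q
  exact Projectivization.mk_eq_mk_iff_crossProduct_eq_zero q.1.2 q.2.2

variable {I : Type*}

theorem Represents.tendsto {l : Filter I} {u : I → Fin 3 → ℝ} {u₀ : Fin 3 → ℝ} {p : I → P2}
    {p₀ : P2} (hp : ∀ i, Represents (u i) (p i)) (hp₀ : Represents u₀ p₀)
    (h : Tendsto u l (𝓝 u₀)) : Tendsto p l (𝓝 p₀) := by
  obtain ⟨hu₀, rfl⟩ := hp₀
  choose hu hup using hp
  obtain rfl : (fun i => Projectivization.mk' ℝ ⟨u i, hu i⟩) = p := funext hup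
  exact (isOpenQuotientMap_mk'.continuous.tendsto ⟨u₀, hu₀⟩).comp (tendsto_subtype_rng.2 h)

theorem exists_tendsto_of_mem_isCompact {X : Type*} [TopologicalSpace X] {K : Set X}
    (hK : IsCompact K) (l : Ultrafilter I) {u : I → X} (hu : ∀ i, u i ∈ K) :
    ∃ x ∈ K, Tendsto u l (𝓝 x) :=
  hK.ultrafilter_le_nhds' (l.map u) (univ_mem' hu : u ⁻¹' K ∈ (l : Filter I))

theorem exists_represents_tendsto (l : Ultrafilter I) {p : I → P2} {p₀ : P2}
    (h : Tendsto p l (𝓝 p₀)) :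
    ∃ (u : I → Fin 3 → ℝ) (u₀ : Fin 3 → ℝ), (∀ i, Represents (u i) (p i)) ∧ Represents u₀ p₀ ∧
      Tendsto u l (𝓝 u₀) := by
  let u : I → Fin 3 → ℝ := fun i => ‖(p i).rep‖⁻¹ • (p i).rep
  have hu : ∀ i, Represents (u i) (p i) := fun i =>
    (represents_rep (p i)).smul (inv_ne_zero (norm_ne_zero_iff.2 (p i).rep_nonzero))
  have hsphere : ∀ i, u i ∈ Metric.sphere (0 : Fin 3 → ℝ) 1 := fun i => by
    simp [u, norm_smul, (p i).rep_nonzero]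
  obtain ⟨u₀, hu₀, hlim⟩ :=
    exists_tendsto_of_mem_isCompact (isCompact_sphere (0 : Fin 3 → ℝ) 1) l hsphere
  have hp₀ : Represents u₀ (Projectivization.mk ℝ u₀ (ne_zero_of_mem_unit_sphere ⟨u₀, hu₀⟩)) :=
    ⟨_, rfl⟩
  exact ⟨u, u₀, hu, tendsto_nhds_unique (Represents.tendsto hu hp₀ hlim) h ▸ hp₀, hlim⟩

end Coordinates

/-! ### Frames and flags -/

section Frames

/-- The columns of `P` are homogeneous coordinates of the points of the frame `y`. -/
def RepresentsFrame (P : Mat3) (y : Frame) : Prop := ∀ j, Represents (P.col j) (y.1 j)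

variable {P : Mat3} {y : Frame}

theorem RepresentsFrame.isUnit_det (hP : RepresentsFrame P y) : IsUnit P.det := by
  rw [← Matrix.isUnit_iff_isUnit_det, ← Matrix.linearIndependent_cols_iff_isUnit]
  choose d hd hcol using fun j => (represents_rep (y.1 j)).exists_eq_smul (hP j)
  rw [show P.col = (fun j => Units.mk0 (d j) (hd j)) • (Projectivization.rep ∘ y.1) from
    funext hcol]
  exact (Projectivization.independent_iff.1 y.2).units_smul _

theorem exists_representsFrame (y : Frame) : ∃ P, RepresentsFrame P y :=
  ⟨Matrix.of fun a j => (y.1 j).rep a, fun j => represents_rep (y.1 j)⟩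

theorem exists_representsFrame_tendsto {I : Type*} (l : Ultrafilter I) {y : I → Frame}
    {y₀ : Frame} (h : Tendsto y l (𝓝 y₀)) :
    ∃ (P : I → Mat3) (P₀ : Mat3), (∀ i, RepresentsFrame (P i) (y i)) ∧ RepresentsFrame P₀ y₀ ∧
      Tendsto P l (𝓝 P₀) := by
  have h' := tendsto_pi_nhds.1 (tendsto_subtype_rng.1 h)
  choose u u₀ hu hu₀ hlim using fun j => exists_represents_tendsto l (h' j)
  exact ⟨fun i => Matrix.of fun a j => u j i a, Matrix.of fun a j => u₀ j a, fun i j => hu j i,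
    hu₀, tendsto_pi_nhds.2 fun a => tendsto_pi_nhds.2 fun j => tendsto_pi_nhds.1 (hlim j) a⟩

theorem eq_of_orthogonal_pair {p q a b : P2} (hpq : p ≠ q) (hpa : p.orthogonal a)
    (hqa : q.orthogonal a) (hpb : p.orthogonal b) (hqb : q.orthogonal b) : a = b :=
  (Configuration.ofField.eq_or_eq_of_orthogonal hpa hqa hpb hqb).resolve_left hpq

theorem inv_mulVec_col {n R : Type*} [Fintype n] [DecidableEq n] [CommRing R]
    {P : Matrix n n R} (hP : IsUnit P.det) (j : n) : P⁻¹ *ᵥ P.col j = Pi.single j 1 := by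
  rw [← Matrix.mulVec_single_one, Matrix.mulVec_mulVec, Matrix.nonsing_inv_mul _ hP,
    Matrix.one_mulVec]

theorem row_inv_dotProduct_col {n R : Type*} [Fintype n] [DecidableEq n] [CommRing R]
    {P : Matrix n n R} (hP : IsUnit P.det) (i j : n) :
    P⁻¹.row i ⬝ᵥ P.col j = (Pi.single j 1 : n → R) i :=
  congrFun (inv_mulVec_col hP j) i

open Classical in
theorem RepresentsFrame.represents_row_inv (hP : RepresentsFrame P y) {i j k : Fin 3}
    (hij : i ≠ j) (hik : i ≠ k) (hjk : j ≠ k) :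
    Represents (P⁻¹.row i) ((y.1 j).cross (y.1 k)) := by
  have hrow : P⁻¹.row i ≠ 0 := fun h => by
    simpa [h] using row_inv_dotProduct_col hP.isUnit_det i i
  have horth (a : Fin 3) (hia : i ≠ a) :
      (y.1 a).orthogonal (Projectivization.mk ℝ (P⁻¹.row i) hrow) := by
    rw [(hP a).orthogonal_iff ⟨hrow, rfl⟩, dotProduct_comm, row_inv_dotProduct_col hP.isUnit_det,
      Pi.single_eq_of_ne hia]
  have hy : y.1 j ≠ y.1 k := y.injective.ne hjk
  exact ⟨hrow, eq_of_orthogonal_pair hy (horth j hij) (horth k hik)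
    (Projectivization.orthogonal_cross_left hy) (Projectivization.orthogonal_cross_right hy)⟩

theorem RepresentsFrame.piPlus_line (hP : RepresentsFrame P y) :
    Represents (P⁻¹.row 2) (piPlus y).line :=
  hP.represents_row_inv (by decide) (by decide) (by decide)

theorem RepresentsFrame.piMinus_line (hP : RepresentsFrame P y) :
    Represents (P⁻¹.row 0) (piMinus y).line :=
  hP.represents_row_inv (by decide) (by decide) (by decide)

theorem tendsto_matrix_inv {I n : Type*} [Fintype n] [DecidableEq n] {l : Filter I}
    {P : I → Matrix n n ℝ} {P₀ : Matrix n n ℝ} (h : Tendsto P l (𝓝 P₀)) (hP₀ : IsUnit P₀.det) :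
    Tendsto (fun i => (P i)⁻¹) l (𝓝 P₀⁻¹) := by
  refine (continuousAt_matrix_inv P₀ ?_).tendsto.comp h
  rw [Ring.inverse_eq_inv']
  exact continuousAt_inv₀ hP₀.ne_zero

theorem continuous_pt : Continuous Flag.pt := continuous_fst.comp continuous_subtype_val

theorem continuous_line : Continuous Flag.line := continuous_snd.comp continuous_subtype_val

theorem continuous_piPlus : Continuous piPlus := by
  refine continuous_iff_ultrafilter.2 fun y l h => ?_
  obtain ⟨P, P₀, hP, hP₀, hlim⟩ := exists_representsFrame_tendsto (y := id) l h
  have hpt : Tendsto (fun y : Frame => y.1 0) l (𝓝 (y.1 0)) :=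
    (((continuous_apply 0).comp continuous_subtype_val).tendsto y).mono_left h
  exact tendsto_subtype_rng.2 <| hpt.prodMk_nhds <|
    Represents.tendsto (fun i => (hP i).piPlus_line) hP₀.piPlus_line
      (tendsto_pi_nhds.1 (tendsto_matrix_inv hlim hP₀.isUnit_det) 2)

theorem Flag.ext {F F' : Flag} (hpt : F.pt = F'.pt) (hline : F.line = F'.line) : F = F' :=
  Subtype.ext (Prod.ext hpt hline)

theorem Flag.smul_pt (g : SL(3, ℝ)) (F : Flag) : (g • F).pt = g • F.pt := rfl

theorem Flag.smul_line (g : SL(3, ℝ)) (F : Flag) : (g • F).line = dual g • F.line := rfl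

theorem piPlus_smul (g : SL(3, ℝ)) (y : Frame) : piPlus (g • y) = g • piPlus y := by
  have h01 : y.1 0 ≠ y.1 1 := y.injective.ne (by decide)
  have hg : (g • y).1 0 ≠ (g • y).1 1 := (g • y).injective.ne (by decide)
  exact Flag.ext rfl <| eq_of_orthogonal_pair hg (Projectivization.orthogonal_cross_left hg)
    (Projectivization.orthogonal_cross_right hg)
    (orthogonal_smul g _ _ (Projectivization.orthogonal_cross_left h01))
    (orthogonal_smul g _ _ (Projectivization.orthogonal_cross_right h01))

end Frames

/-! ### Proximal dynamics -/

section Proximal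

variable {I : Type*}

theorem tendsto_inv_smul_mul_diagonal_mul_mulVec {m n k 𝕜 : Type*} [Fintype n] [Fintype k]
    [DecidableEq k] [Field 𝕜] [TopologicalSpace 𝕜] [IsTopologicalRing 𝕜] {l : Filter I}
    {P : I → Matrix m k 𝕜} {P₀ : Matrix m k 𝕜} {R : I → Matrix k n 𝕜} {R₀ : Matrix k n 𝕜}
    {d : I → k → 𝕜} {j₀ : k} (hd : ∀ i, d i j₀ ≠ 0)
    (hdom : ∀ j ≠ j₀, Tendsto (fun i => d i j / d i j₀) l (𝓝 0))
    (hP : Tendsto P l (𝓝 P₀)) (hR : Tendsto R l (𝓝 R₀)) {v : I → n → 𝕜} {v₀ : n → 𝕜}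
    (hv : Tendsto v l (𝓝 v₀)) :
    Tendsto (fun i => (d i j₀)⁻¹ • ((P i * Matrix.diagonal (d i) * R i) *ᵥ v i)) l
      (𝓝 ((R₀.row j₀ ⬝ᵥ v₀) • P₀.col j₀)) := by
  have hratio : Tendsto (fun i => (d i j₀)⁻¹ • d i) l (𝓝 (Pi.single j₀ 1)) := by
    refine tendsto_pi_nhds.2 fun j => ?_
    rcases eq_or_ne j j₀ with rfl | hj
    · simpa [hd] using tendsto_const_nhds
    · simpa [hj, div_eq_inv_mul] using hdom j hj
  have hcont : Continuous fun q : Matrix m k 𝕜 × (k → 𝕜) × Matrix k n 𝕜 × (n → 𝕜) =>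
      q.1 *ᵥ (Matrix.diagonal q.2.1 *ᵥ (q.2.2.1 *ᵥ q.2.2.2)) := by
    fun_prop
  have hlim := (hcont.tendsto (P₀, Pi.single j₀ 1, R₀, v₀)).comp
    (hP.prodMk_nhds (hratio.prodMk_nhds (hR.prodMk_nhds hv)))
  have hlimit : P₀ *ᵥ (Matrix.diagonal (Pi.single j₀ 1) *ᵥ (R₀ *ᵥ v₀)) =
      (R₀.row j₀ ⬝ᵥ v₀) • P₀.col j₀ := by
    rw [Matrix.diagonal_single, Matrix.single_mulVec, ← Matrix.mulVec_single_one,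
      ← Matrix.mulVec_smul, ← Pi.single_smul, smul_eq_mul, mul_one, one_mul]
    rfl
  rw [← hlimit]
  refine hlim.congr fun i => ?_
  simp only [Function.comp_apply, Matrix.diagonal_smul, Matrix.smul_mulVec, Matrix.mulVec_smul,
    ← Matrix.mulVec_mulVec]

/-- The transformations `g i` of the projective plane attract the points off the line `q` to the
point `p`, locally uniformly; `l` is an ultrafilter because limits of points are lifted to limits of
homogeneous coordinates. -/
def AttractsPoints (l : Ultrafilter I) (g : I → SL(3, ℝ)) (p q : P2) : Prop :=
  ∀ (z : I → P2) (z₀ : P2), Tendsto z l (𝓝 z₀) → ¬ z₀.orthogonal q →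
    Tendsto (fun i => g i • z i) l (𝓝 p)

/-- The transformations `g i` attract points off the line of `F'` to the point of `F`, and lines off
the point of `F'` to the line of `F`. -/
def Attracts (l : Ultrafilter I) (g : I → SL(3, ℝ)) (F F' : Flag) : Prop :=
  AttractsPoints l g F.pt F'.line ∧ AttractsPoints l (fun i => dual (g i)) F.line F'.pt

variable {l : Ultrafilter I} {g : I → SL(3, ℝ)}

theorem AttractsPoints.unique {p q p' q' : P2} (h : AttractsPoints l g p q)
    (h' : AttractsPoints l g p' q') : p = p' := by
  obtain ⟨z, hq, hq'⟩ := exists_not_orthogonal_pair q q'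
  exact tendsto_nhds_unique (h _ z tendsto_const_nhds hq) (h' _ z tendsto_const_nhds hq')

theorem Attracts.unique {F₁ F₁' F₂ F₂' : Flag} (h₁ : Attracts l g F₁ F₁')
    (h₂ : Attracts l g F₂ F₂') : F₁ = F₂ :=
  Flag.ext (h₁.1.unique h₂.1) (h₁.2.unique h₂.2)

theorem Flag.pt_eq_or_line_eq {F F' : Flag} (hpt : F.pt.orthogonal F'.line)
    (hline : F.line.orthogonal F'.pt) : F.pt = F'.pt ∨ F.line = F'.line :=
  Configuration.ofField.eq_or_eq_of_orthogonal F.2 (Projectivization.orthogonal_comm.1 hline) hpt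
    F'.2

theorem Attracts.pt_eq_or_line_eq {F F' : Flag} (h : Attracts l g F F') {x : I → Flag}
    {x₀ x₁ : Flag} (hx : Tendsto x l (𝓝 x₀)) (hgx : Tendsto (fun i => g i • x i) l (𝓝 x₁)) :
    (x₀.pt = F'.pt ∨ x₀.line = F'.line) ∨ x₁.pt = F.pt ∨ x₁.line = F.line := by
  by_cases hpt : x₀.pt.orthogonal F'.line
  · by_cases hline : x₀.line.orthogonal F'.pt
    · exact .inl (Flag.pt_eq_or_line_eq hpt hline)
    · exact .inr <| .inr <| tendsto_nhds_unique ((continuous_line.tendsto x₁).comp hgx)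
        (h.2 _ _ ((continuous_line.tendsto x₀).comp hx) hline)
  · exact .inr <| .inl <| tendsto_nhds_unique ((continuous_pt.tendsto x₁).comp hgx)
      (h.1 _ _ ((continuous_pt.tendsto x₀).comp hx) hpt)

theorem attractsPoints_of_eq_mul_diagonal_mul {P R : I → Mat3} {P₀ R₀ : Mat3} {d : I → Fin 3 → ℝ}
    {j₀ : Fin 3} (hg : ∀ i, (g i).1 = P i * Matrix.diagonal (d i) * R i)
    (hP : Tendsto P l (𝓝 P₀)) (hR : Tendsto R l (𝓝 R₀)) (hd : ∀ i, d i j₀ ≠ 0)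
    (hdom : ∀ j ≠ j₀, Tendsto (fun i => d i j / d i j₀) l (𝓝 0)) {p q : P2}
    (hp : Represents (P₀.col j₀) p) (hq : Represents (R₀.row j₀) q) : AttractsPoints l g p q := by
  intro z z₀ hz hz₀
  obtain ⟨v, v₀, hv, hv₀, hlim⟩ := exists_represents_tendsto l hz
  rw [hv₀.orthogonal_iff hq, dotProduct_comm] at hz₀
  refine Represents.tendsto (fun i => ((hv i).mulVec (g i)).smul (inv_ne_zero (hd i)))
    (hp.smul hz₀) ?_
  simpa only [hg] using tendsto_inv_smul_mul_diagonal_mul_mulVec hd hdom hP hR hlim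

end Proximal

/-! ### Diagonalization in moving frames -/

section Diagonalization

variable {n K : Type*} [Fintype n] [DecidableEq n] [Field K]

theorem coe_inv_eq_mul_diagonal_mul {g : Matrix.SpecialLinearGroup n K} {P Q : Matrix n n K}
    {d : n → K} (hg : g.1 = P * Matrix.diagonal d * Q⁻¹) (hP : IsUnit P.det) (hQ : IsUnit Q.det)
    (hd : ∀ j, d j ≠ 0) : (g⁻¹).1 = Q * Matrix.diagonal d⁻¹ * P⁻¹ := by
  have hdiag : Matrix.diagonal d * Matrix.diagonal d⁻¹ = 1 := by
    simp [Matrix.diagonal_mul_diagonal, hd]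
  refine left_inv_eq_right_inv (congrArg Subtype.val (inv_mul_cancel g)) ?_
  calc g.1 * (Q * Matrix.diagonal d⁻¹ * P⁻¹)
      = P * (Matrix.diagonal d * (Q⁻¹ * Q) * Matrix.diagonal d⁻¹) * P⁻¹ := by
        simp only [hg, Matrix.mul_assoc]
    _ = 1 := by
        rw [Matrix.nonsing_inv_mul _ hQ, Matrix.mul_one, hdiag, Matrix.mul_one,
          Matrix.mul_nonsing_inv _ hP]

theorem exists_eq_mul_diagonal_mul_inv {g : SL(3, ℝ)} {y y' : Frame} {P Q : Mat3}
    (hP : RepresentsFrame P y) (hQ : RepresentsFrame Q y') (hg : g • y' = y) :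
    ∃ d : Fin 3 → ℝ, (∀ j, d j ≠ 0) ∧ g.1 = P * Matrix.diagonal d * Q⁻¹ := by
  subst hg
  choose d hd hcol using fun j => (hP j).exists_eq_smul ((hQ j).mulVec g)
  have hgQ : g.1 * Q = P * Matrix.diagonal d := by
    ext a j
    rw [Matrix.mul_diagonal, mul_comm]
    exact congrFun (hcol j) a
  exact ⟨d, hd, by rw [← hgQ, Matrix.mul_nonsing_inv_cancel_right _ _ hQ.isUnit_det]⟩

/-- The matrix that maps the `k`-th column of `P` to the `j`-th one and the other columns to `0`. -/
def rootMatrix (j k : n) (P : Matrix n n K) : Matrix n n K := P * Matrix.single j k 1 * P⁻¹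

theorem rootMatrix_mulVec_col {P : Matrix n n K} (hP : IsUnit P.det) (j k : n) :
    rootMatrix j k P *ᵥ P.col k = P.col j := by
  rw [rootMatrix, ← Matrix.mulVec_mulVec, inv_mulVec_col hP, ← Matrix.mulVec_mulVec,
    Matrix.single_mulVec_eq, Pi.single_eq_same, mul_one, one_smul, Matrix.mulVec_single_one]

theorem rootMatrix_mulVec_col_of_ne {P : Matrix n n K} (hP : IsUnit P.det) (j : n) {i k : n}
    (hik : i ≠ k) : rootMatrix j k P *ᵥ P.col i = 0 := by
  rw [rootMatrix, ← Matrix.mulVec_mulVec, inv_mulVec_col hP, ← Matrix.mulVec_mulVec,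
    Matrix.single_mulVec_eq, Pi.single_eq_of_ne hik.symm, mul_zero, zero_smul, Matrix.mulVec_zero]

theorem transpose_rootMatrix {P : Matrix n n K} (hP : IsUnit P.det) (j k : n) :
    (rootMatrix j k P)ᵀ = rootMatrix k j (P⁻¹)ᵀ := by
  rw [rootMatrix, rootMatrix, Matrix.transpose_mul, Matrix.transpose_mul, Matrix.transpose_single,
    ← Matrix.transpose_nonsing_inv, Matrix.nonsing_inv_nonsing_inv _ hP, Matrix.mul_assoc]

theorem conj_rootMatrix {g : Matrix.SpecialLinearGroup n K} {P Q : Matrix n n K} {d : n → K}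
    (hg : g.1 = P * Matrix.diagonal d * Q⁻¹) (hP : IsUnit P.det) (hQ : IsUnit Q.det)
    (hd : ∀ j, d j ≠ 0) (j k : n) :
    g.1 * rootMatrix j k Q * (g⁻¹).1 = (d j / d k) • rootMatrix j k P := by
  have hdiag : Matrix.diagonal d * Matrix.single j k 1 * Matrix.diagonal d⁻¹ =
      (d j / d k) • Matrix.single j k 1 := by
    ext a b
    rw [Matrix.mul_diagonal, Matrix.diagonal_mul, Matrix.smul_apply, Matrix.single_apply]
    split_ifs with h
    · simp [h.1, h.2, div_eq_mul_inv]
    · simp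
  calc g.1 * rootMatrix j k Q * (g⁻¹).1
      = P * (Matrix.diagonal d * (Q⁻¹ * Q) * Matrix.single j k 1 * (Q⁻¹ * Q) *
          Matrix.diagonal d⁻¹) * P⁻¹ := by
        simp only [rootMatrix, hg, coe_inv_eq_mul_diagonal_mul hg hP hQ hd, Matrix.mul_assoc]
    _ = (d j / d k) • rootMatrix j k P := by
        rw [Matrix.nonsing_inv_mul _ hQ, Matrix.mul_one, Matrix.mul_one, hdiag, Matrix.mul_smul,
          Matrix.smul_mul, rootMatrix]

theorem tendsto_rootMatrix {I : Type*} {l : Filter I} {P : I → Matrix n n ℝ} {P₀ : Matrix n n ℝ}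
    (h : Tendsto P l (𝓝 P₀)) (hP₀ : IsUnit P₀.det) (j k : n) :
    Tendsto (fun i => rootMatrix j k (P i)) l (𝓝 (rootMatrix j k P₀)) :=
  (h.mul_const _).mul (tendsto_matrix_inv h hP₀)

variable {P : Mat3} {y : Frame} {j k : Fin 3}

theorem RepresentsFrame.fixesFlag_rootMatrix (hP : RepresentsFrame P y) (hjk : j < k) :
    FixesFlag (rootMatrix j k P) (piPlus y) := by
  refine ⟨((hP 0).preservesLine_iff _).2 ⟨0, ?_⟩, (hP.piPlus_line.preservesLine_iff _).2 ⟨0, ?_⟩⟩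
  · rw [rootMatrix_mulVec_col_of_ne hP.isUnit_det _ (by lia), zero_smul]
  · rw [transpose_rootMatrix hP.isUnit_det, zero_smul]
    exact (rootMatrix_mulVec_col_of_ne (Matrix.isUnit_det_transpose _
      (Matrix.isUnit_nonsing_inv_det _ hP.isUnit_det)) _ (by lia)).symm

theorem RepresentsFrame.not_fixesFrame_rootMatrix (hP : RepresentsFrame P y) (hjk : j ≠ k) :
    ¬ FixesFrame (rootMatrix j k P) y := by
  intro h
  obtain ⟨c, hc⟩ := ((hP k).preservesLine_iff _).1 (h k)
  rw [rootMatrix_mulVec_col hP.isUnit_det] at hc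
  have hj := congrFun (congrArg (P⁻¹ *ᵥ ·) hc) j
  simp [Matrix.mulVec_smul, inv_mulVec_col hP.isUnit_det, hjk] at hj

end Diagonalization

section Attraction

variable {I : Type*} {l : Ultrafilter I} {g : I → SL(3, ℝ)}

theorem attracts_of_eq_mul_diagonal_mul_inv {P Q : I → Mat3} {P₀ Q₀ : Mat3} {d : I → Fin 3 → ℝ}
    {y y' : Frame} (hg : ∀ i, (g i).1 = P i * Matrix.diagonal (d i) * (Q i)⁻¹)
    (hPu : ∀ i, IsUnit (P i).det) (hQu : ∀ i, IsUnit (Q i).det) (hd : ∀ i j, d i j ≠ 0)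
    (hgap : ∀ j k : Fin 3, j < k → Tendsto (fun i => d i k / d i j) l (𝓝 0))
    (hP : Tendsto P l (𝓝 P₀)) (hQ : Tendsto Q l (𝓝 Q₀)) (hP₀ : RepresentsFrame P₀ y)
    (hQ₀ : RepresentsFrame Q₀ y') :
    Attracts l g (piPlus y) (piMinus y') ∧
      Attracts l (fun i => (g i)⁻¹) (piMinus y') (piPlus y) := by
  have hP' := tendsto_matrix_inv hP hP₀.isUnit_det
  have hQ' := tendsto_matrix_inv hQ hQ₀.isUnit_det
  have hginv i : ((g i)⁻¹).1 = Q i * Matrix.diagonal (d i)⁻¹ * (P i)⁻¹ :=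
    coe_inv_eq_mul_diagonal_mul (hg i) (hPu i) (hQu i) (hd i)
  have htop (j : Fin 3) (hj : j ≠ 0) : Tendsto (fun i => d i j / d i 0) l (𝓝 0) :=
    hgap 0 j (by lia)
  have hbot (j : Fin 3) (hj : j ≠ 2) : Tendsto (fun i => (d i)⁻¹ j / (d i)⁻¹ 2) l (𝓝 0) := by
    simpa only [Pi.inv_apply, inv_div_inv] using hgap j 2 (by lia)
  have hd' i : (d i)⁻¹ 2 ≠ 0 := inv_ne_zero (hd i 2)
  have htrans : Continuous (Matrix.transpose : Mat3 → Mat3) := continuous_id.matrix_transpose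
  refine ⟨⟨?_, ?_⟩, ?_, ?_⟩
  · exact attractsPoints_of_eq_mul_diagonal_mul hg hP hQ' (fun i => hd i 0) htop (hP₀ 0)
      hQ₀.piMinus_line
  · refine attractsPoints_of_eq_mul_diagonal_mul (fun i => ?_) ((htrans.tendsto _).comp hP')
      ((htrans.tendsto _).comp hQ) hd' hbot hP₀.piPlus_line (hQ₀ 2)
    change ((g i)⁻¹).1ᵀ = _
    rw [hginv, Matrix.transpose_mul, Matrix.transpose_mul, Matrix.diagonal_transpose,
      ← Matrix.mul_assoc]
    rfl
  · exact attractsPoints_of_eq_mul_diagonal_mul hginv hQ hP' hd' hbot (hQ₀ 2) hP₀.piPlus_line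
  · refine attractsPoints_of_eq_mul_diagonal_mul (fun i => ?_) ((htrans.tendsto _).comp hQ')
      ((htrans.tendsto _).comp hP) (fun i => hd i 0) htop hQ₀.piMinus_line (hP₀ 0)
    change ((g i)⁻¹⁻¹).1ᵀ = _
    rw [inv_inv, hg, Matrix.transpose_mul, Matrix.transpose_mul, Matrix.diagonal_transpose,
      ← Matrix.mul_assoc]
    rfl

end Attraction

/-! ### Decompositions of `SL(2, ℝ)` -/

section FrobeniusNorm

variable {n : Type*} [Fintype n] [DecidableEq n]

/-- The square of the Frobenius norm. Its sublevel sets are compact, so it measures the distance to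
infinity in `SL(n, ℝ)`. -/
def frobeniusSq (h : Matrix.SpecialLinearGroup n ℝ) : ℝ := ∑ i, ∑ j, h i j ^ 2

theorem frobeniusSq_eq_trace (h : Matrix.SpecialLinearGroup n ℝ) :
    frobeniusSq h = (h.1ᵀ * h.1).trace := by
  simp only [frobeniusSq, Matrix.trace, Matrix.diag, Matrix.mul_apply, Matrix.transpose_apply,
    ← sq]
  exact Finset.sum_comm

theorem frobeniusSq_nonneg (h : Matrix.SpecialLinearGroup n ℝ) : 0 ≤ frobeniusSq h := by
  unfold frobeniusSq
  positivity

theorem continuous_entry (i j : n) : Continuous fun h : Matrix.SpecialLinearGroup n ℝ => h i j :=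
  (continuous_apply_apply i j).comp continuous_subtype_val

theorem bddBelow_range_frobeniusSq :
    BddBelow (Set.range (frobeniusSq : Matrix.SpecialLinearGroup n ℝ → ℝ)) :=
  ⟨0, Set.forall_mem_range.2 frobeniusSq_nonneg⟩

theorem continuous_frobeniusSq :
    Continuous (frobeniusSq : Matrix.SpecialLinearGroup n ℝ → ℝ) :=
  continuous_finsetSum _ fun i _ => continuous_finsetSum _ fun j _ => (continuous_entry i j).pow 2

theorem sq_entry_le_frobeniusSq (h : Matrix.SpecialLinearGroup n ℝ) (i j : n) :
    h i j ^ 2 ≤ frobeniusSq h :=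
  (Finset.single_le_sum (f := fun j => h i j ^ 2) (fun _ _ => sq_nonneg _)
    (Finset.mem_univ j)).trans <|
    Finset.single_le_sum (f := fun i => ∑ j, h i j ^ 2)
      (fun _ _ => Finset.sum_nonneg fun _ _ => sq_nonneg _) (Finset.mem_univ i)

theorem isCompact_frobeniusSq_le (R : ℝ) :
    IsCompact {h : Matrix.SpecialLinearGroup n ℝ | frobeniusSq h ≤ R} := by
  have hbox : IsCompact (Set.pi Set.univ fun _ : n => Set.pi Set.univ fun _ : n =>
      Set.Icc (-√R) (√R)) :=
    isCompact_univ_pi fun _ => isCompact_univ_pi fun _ => isCompact_Icc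
  have hpre := Matrix.SpecialLinearGroup.isClosedEmbedding_val.isCompact_preimage hbox
  refine hpre.of_isClosed_subset (isClosed_le continuous_frobeniusSq continuous_const) ?_
  intro h hh i _ j _
  exact abs_le.1 (Real.abs_le_sqrt ((sq_entry_le_frobeniusSq h i j).trans hh))

theorem frobeniusSq_mul_left {k : Matrix.SpecialLinearGroup n ℝ} (hk : k.1ᵀ * k.1 = 1)
    (h : Matrix.SpecialLinearGroup n ℝ) : frobeniusSq (k * h) = frobeniusSq h := by
  rw [frobeniusSq_eq_trace, frobeniusSq_eq_trace, Matrix.SpecialLinearGroup.coe_mul,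
    Matrix.transpose_mul, Matrix.mul_assoc, ← Matrix.mul_assoc _ k.1, hk, Matrix.one_mul]

theorem frobeniusSq_mul_right {k : Matrix.SpecialLinearGroup n ℝ} (hk : k.1ᵀ * k.1 = 1)
    (h : Matrix.SpecialLinearGroup n ℝ) : frobeniusSq (h * k) = frobeniusSq h := by
  rw [frobeniusSq_eq_trace, frobeniusSq_eq_trace, Matrix.SpecialLinearGroup.coe_mul,
    Matrix.transpose_mul, Matrix.mul_assoc, Matrix.trace_mul_comm, Matrix.mul_assoc,
    Matrix.mul_assoc, mul_eq_one_comm.1 hk, Matrix.mul_one]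

end FrobeniusNorm

instance : T2Space SL(2, ℝ) := inferInstanceAs (T2Space (Subtype _))

/-- The rotation of angle `θ`. -/
def rotation (θ : ℝ) : SL(2, ℝ) :=
  ⟨!![Real.cos θ, -Real.sin θ; Real.sin θ, Real.cos θ], by
    rw [Matrix.det_fin_two_of]; linear_combination Real.cos_sq_add_sin_sq θ⟩

theorem coe_rotation (θ : ℝ) :
    (rotation θ).1 = !![Real.cos θ, -Real.sin θ; Real.sin θ, Real.cos θ] := rfl

theorem coe_diagFlow (t : ℝ) : (diagFlow t).1 = !![Real.exp t, 0; 0, Real.exp (-t)] := rfl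

theorem continuous_rotation : Continuous rotation :=
  Continuous.subtype_mk (by fun_prop) _

theorem isCompact_range_rotation : IsCompact (Set.range rotation) := by
  have hper : Function.Periodic rotation (2 * Real.pi) := fun θ =>
    Subtype.ext (by simp only [coe_rotation, Real.cos_add_two_pi, Real.sin_add_two_pi])
  rw [← hper.image_Icc Real.two_pi_pos 0]
  exact isCompact_Icc.image continuous_rotation

theorem continuous_diagFlow : Continuous diagFlow :=
  Continuous.subtype_mk (by fun_prop) _

theorem transpose_rotation_mul_rotation (θ : ℝ) : (rotation θ).1ᵀ * (rotation θ).1 = 1 := by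
  ext i j
  fin_cases i <;> fin_cases j <;>
    simp [coe_rotation, Matrix.mul_apply, ← sq, mul_comm, add_comm]

theorem rotation_add (θ θ' : ℝ) : rotation (θ + θ') = rotation θ * rotation θ' := by
  apply Subtype.ext
  simp only [Matrix.SpecialLinearGroup.coe_mul, coe_rotation, Matrix.mul_fin_two, Real.cos_add,
    Real.sin_add]
  ext i j
  fin_cases i <;> fin_cases j <;>
    simp only [Fin.zero_eta, Fin.mk_one, Matrix.of_apply, Matrix.cons_val', Matrix.cons_val_zero,
      Matrix.cons_val_one, Matrix.cons_val_fin_one] <;>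
    ring

theorem diagFlow_add (s t : ℝ) : diagFlow (s + t) = diagFlow s * diagFlow t := by
  apply Subtype.ext
  simp [coe_diagFlow, Matrix.SpecialLinearGroup.coe_mul, Real.exp_add, mul_comm]

theorem diagFlow_zero : diagFlow 0 = 1 := by
  apply Subtype.ext
  simp [coe_diagFlow, Matrix.one_fin_two]

theorem diagFlow_mul_rotation_pi_div_two (t : ℝ) :
    diagFlow t * rotation (Real.pi / 2) = rotation (Real.pi / 2) * diagFlow (-t) := by
  apply Subtype.ext
  simp [coe_diagFlow, coe_rotation, Matrix.SpecialLinearGroup.coe_mul]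

theorem frobeniusSq_diagFlow (t : ℝ) :
    frobeniusSq (diagFlow t) = Real.exp (2 * t) + Real.exp (-(2 * t)) := by
  simp [frobeniusSq, coe_diagFlow, ← Real.exp_nat_mul]

theorem frobeniusSq_mul_diagFlow_le (h : SL(2, ℝ)) {t : ℝ} (ht : 0 ≤ t) :
    frobeniusSq (h * diagFlow t) ≤ Real.exp (2 * t) * frobeniusSq h := by
  have hle : Real.exp (-t) ^ 2 ≤ Real.exp t ^ 2 := by gcongr; linarith
  have hsq : Real.exp (2 * t) = Real.exp t ^ 2 := by rw [← Real.exp_nat_mul]; norm_num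
  simp only [frobeniusSq, coe_diagFlow, Matrix.SpecialLinearGroup.coe_mul, Matrix.mul_apply,
    Fin.sum_univ_two, Matrix.of_apply, Matrix.cons_val', Matrix.cons_val_zero,
    Matrix.cons_val_one, Matrix.cons_val_fin_one, mul_zero, zero_add, add_zero, hsq]
  nlinarith [mul_le_mul_of_nonneg_left hle (sq_nonneg (h 0 1)),
    mul_le_mul_of_nonneg_left hle (sq_nonneg (h 1 1))]

theorem exists_eq_rotation_mul_upper (h : SL(2, ℝ)) :
    ∃ (θ : ℝ) (b : SL(2, ℝ)), h = rotation θ * b ∧ b 1 0 = 0 ∧ 0 ≤ b 0 0 := by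
  obtain ⟨r, θ, hr, h0, h1⟩ : ∃ r θ, 0 ≤ r ∧ h 0 0 = r * Real.cos θ ∧ h 1 0 = r * Real.sin θ :=
    let z : ℂ := ⟨h 0 0, h 1 0⟩
    ⟨‖z‖, z.arg, norm_nonneg z, (Complex.norm_mul_cos_arg z).symm,
      (Complex.norm_mul_sin_arg z).symm⟩
  refine ⟨θ, (rotation θ)⁻¹ * h, (mul_inv_cancel_left _ _).symm, ?_, ?_⟩
  all_goals
    simp only [Matrix.SpecialLinearGroup.coe_mul, Matrix.SpecialLinearGroup.coe_inv, coe_rotation,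
      Matrix.adjugate_fin_two_of, Matrix.mul_apply, Fin.sum_univ_two, h0, h1, Matrix.of_apply,
      Matrix.cons_val', Matrix.cons_val_zero, Matrix.cons_val_one, Matrix.cons_val_fin_one]
  · ring
  · nlinarith [Real.cos_sq_add_sin_sq θ]

theorem eq_diagFlow_of_diagonal {b : SL(2, ℝ)} (h10 : b 1 0 = 0) (h01 : b 0 1 = 0)
    (h00 : 0 < b 0 0) : b = diagFlow (Real.log (b 0 0)) := by
  have hdet := b.2
  rw [Matrix.det_fin_two, h10, h01, mul_zero, sub_zero] at hdet
  have h11 : b 1 1 = (b 0 0)⁻¹ := eq_inv_of_mul_eq_one_right hdet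
  apply Subtype.ext
  rw [coe_diagFlow, Real.exp_neg, Real.exp_log h00, ← h11, ← h10]
  nth_rewrite 1 [Matrix.eta_fin_two b.1]
  rw [h01, h10]

/-- The Gram matrix of `g` in an orthonormal basis rotated by `π / 2` has the opposite off-diagonal
entry, which therefore vanishes for an intermediate rotation. -/
theorem exists_mul_rotation_orthogonal_columns (g : SL(2, ℝ)) :
    ∃ θ, ((g * rotation θ).1ᵀ * (g * rotation θ).1) 0 1 = 0 := by
  set β : ℝ → ℝ := fun θ => ((g * rotation θ).1ᵀ * (g * rotation θ).1) 0 1 with hβ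
  have hcont : Continuous β := by
    have h : Continuous fun θ => (g * rotation θ).1 :=
      continuous_subtype_val.comp (continuous_const.mul continuous_rotation)
    exact (h.matrix_transpose.matrix_mul h).matrix_elem 0 1
  have hneg : β (Real.pi / 2) = -β 0 := by
    simp only [hβ, Matrix.SpecialLinearGroup.coe_mul, coe_rotation, Matrix.mul_apply,
      Matrix.transpose_apply, Fin.sum_univ_two, Matrix.of_apply, Matrix.cons_val',
      Matrix.cons_val_zero, Matrix.cons_val_one, Matrix.cons_val_fin_one, Real.cos_pi_div_two,
      Real.sin_pi_div_two, Real.cos_zero, Real.sin_zero]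
    ring
  suffices ∃ θ, β θ = 0 from this
  rcases le_total (β 0) 0 with h | h
  · exact mem_range_of_exists_le_of_exists_ge hcont ⟨0, h⟩ ⟨Real.pi / 2, by rw [hneg]; linarith⟩
  · exact mem_range_of_exists_le_of_exists_ge hcont ⟨Real.pi / 2, by rw [hneg]; linarith⟩ ⟨0, h⟩

theorem exists_mul_rotation_eq_rotation_mul_diagFlow (g : SL(2, ℝ)) :
    ∃ θ θ' t, 0 ≤ t ∧ g * rotation θ' = rotation θ * diagFlow t := by
  obtain ⟨θ', horth⟩ := exists_mul_rotation_orthogonal_columns g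
  obtain ⟨θ, b, hb, h10, h00⟩ := exists_eq_rotation_mul_upper (g * rotation θ')
  have hpos : 0 < b 0 0 := by
    refine lt_of_le_of_ne h00 fun h => ?_
    have hdet := b.2
    rw [Matrix.det_fin_two, h10, ← h] at hdet
    norm_num at hdet
  have h01 : b 0 1 = 0 := by
    rw [hb, Matrix.SpecialLinearGroup.coe_mul, Matrix.transpose_mul, Matrix.mul_assoc,
      ← Matrix.mul_assoc _ (rotation θ).1, transpose_rotation_mul_rotation, Matrix.one_mul] at horth
    simpa [Matrix.mul_apply, h10, hpos.ne'] using horth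
  rw [eq_diagFlow_of_diagonal h10 h01 hpos] at hb
  rcases le_total 0 (Real.log (b 0 0)) with ht | ht
  · exact ⟨θ, θ', _, ht, hb⟩
  · refine ⟨θ + Real.pi / 2, θ' + Real.pi / 2, _, neg_nonneg.2 ht, ?_⟩
    rw [rotation_add, rotation_add, ← mul_assoc, hb, mul_assoc, diagFlow_mul_rotation_pi_div_two,
      mul_assoc]

theorem exists_tendsto_diagFlow_conj {b : SL(2, ℝ)} (hb : b 1 0 = 0) :
    ∃ b₀, Tendsto (fun t => diagFlow (-t) * b * diagFlow t) atTop (𝓝 b₀) := by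
  have hdet := b.2
  rw [Matrix.det_fin_two, hb, mul_zero, sub_zero] at hdet
  have hbeq : b.1 = !![b 0 0, b 0 1; 0, b 1 1] := hb ▸ Matrix.eta_fin_two b.1
  refine ⟨⟨!![b 0 0, 0; 0, b 1 1], by simpa using hdet⟩, tendsto_subtype_rng.2 ?_⟩
  have hconj t : (diagFlow (-t) * b * diagFlow t).1 =
      !![b 0 0, b 0 1 * Real.exp (-t) ^ 2; 0, b 1 1] := by
    have hexp : Real.exp (-t) * Real.exp t = 1 := by rw [← Real.exp_add]; simp
    rw [Matrix.SpecialLinearGroup.coe_mul, Matrix.SpecialLinearGroup.coe_mul, coe_diagFlow,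
      coe_diagFlow, hbeq, Matrix.mul_fin_two, Matrix.mul_fin_two, neg_neg]
    ext i j
    fin_cases i <;> fin_cases j <;>
      simp only [Fin.zero_eta, Fin.mk_one, Matrix.of_apply, Matrix.cons_val', Matrix.cons_val_zero,
        Matrix.cons_val_one, Matrix.cons_val_fin_one]
    · linear_combination b 0 0 * hexp
    · ring
    · ring
    · linear_combination b 1 1 * hexp
  have hlim : Tendsto (fun t => !![b 0 0, b 0 1 * Real.exp (-t) ^ 2; 0, b 1 1]) atTop
      (𝓝 !![b 0 0, b 0 1 * 0 ^ 2; 0, b 1 1]) := by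
    have hcont : Continuous fun x : ℝ => !![b 0 0, b 0 1 * x ^ 2; 0, b 1 1] := by fun_prop
    exact (hcont.tendsto 0).comp Real.tendsto_exp_neg_atTop_nhds_zero
  simp only [hconj]
  simpa using hlim

/-! ### Discrete subgroups of topological groups -/

section OrbitInf

variable {Γ G : Type*} [Group Γ] [Group G] {ι : Γ →* G} {ψ : G → ℝ}

/-- The infimum of `ψ` over the orbit of `h` under left multiplication by the image of `ι`. For
proper `ψ` this measures the distance to infinity in the quotient of `G` by the image of `ι`. -/
def orbitInf (ι : Γ →* G) (ψ : G → ℝ) (h : G) : ℝ := ⨅ γ, ψ (ι γ * h)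

theorem orbitInf_map_mul (α : Γ) (h : G) : orbitInf ι ψ (ι α * h) = orbitInf ι ψ h := by
  simpa only [orbitInf, Equiv.coe_mulRight, map_mul, mul_assoc] using
    (Equiv.mulRight α).surjective.iInf_comp fun γ => ψ (ι γ * h)

theorem orbitInf_mul_right {k : G} (hk : ∀ h, ψ (h * k) = ψ h) (h : G) :
    orbitInf ι ψ (h * k) = orbitInf ι ψ h := by
  simp only [orbitInf, ← mul_assoc, hk]

theorem orbitInf_le (hψ : BddBelow (Set.range ψ)) (h : G) (γ : Γ) :
    orbitInf ι ψ h ≤ ψ (ι γ * h) :=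
  ciInf_le (hψ.mono (Set.range_comp_subset_range (fun γ => ι γ * h) ψ)) γ

theorem orbitInf_le_self (hψ : BddBelow (Set.range ψ)) (h : G) : orbitInf ι ψ h ≤ ψ h := by
  simpa only [map_one, one_mul] using orbitInf_le hψ h (1 : Γ)

end OrbitInf

section DiscreteSubgroup

variable {Γ G : Type*} [Group Γ] [Group G] [TopologicalSpace G] [IsTopologicalGroup G] [T2Space G]
  {ι : Γ →* G} {ψ : G → ℝ}

theorem finite_setOf_map_mem_isCompact (hι : Function.Injective ι)
    (hdisc : DiscreteTopology ι.range) {K : Set G} (hK : IsCompact K) : {γ | ι γ ∈ K}.Finite := by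
  have h := MonoidHom.tendsto_coe_cofinite_of_discrete hι (isDiscrete_iff_discreteTopology.2 hdisc)
    hK.compl_mem_cocompact
  rwa [mem_map, mem_cofinite, ← Set.preimage_compl, compl_compl] at h

theorem finite_setOf_map_mul_mem_isCompact (hι : Function.Injective ι)
    (hdisc : DiscreteTopology ι.range) {K K' : Set G} (hK : IsCompact K) (hK' : IsCompact K') :
    {γ | ∃ h ∈ K, ι γ * h ∈ K'}.Finite := by
  refine (finite_setOf_map_mem_isCompact hι hdisc (hK'.mul hK.inv)).subset ?_
  rintro γ ⟨h, hh, hγh⟩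
  exact ⟨_, hγh, h⁻¹, Set.inv_mem_inv.2 hh, mul_inv_cancel_right _ _⟩

theorem tendsto_cofinite_atTop_of_map_mul_eq (hι : Function.Injective ι)
    (hdisc : DiscreteTopology ι.range) {K K' : Set G} (hK : IsCompact K) (hK' : IsCompact K')
    {a : ℝ → G} (ha : Continuous a) {I : Type*} {γ : I → Γ} (hγ : Function.Injective γ)
    {c h : I → G} {t : I → ℝ} (hc : ∀ i, c i ∈ K) (hh : ∀ i, h i ∈ K') (ht : ∀ i, 0 ≤ t i)
    (heq : ∀ i, ι (γ i) * c i = h i * a (t i)) : Tendsto t cofinite atTop := by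
  refine tendsto_atTop.2 fun M => eventually_cofinite.2 ?_
  have hfin := finite_setOf_map_mul_mem_isCompact hι hdisc hK
    (hK'.mul (isCompact_Icc.image ha : IsCompact (a '' Set.Icc 0 M)))
  refine (hfin.preimage hγ.injOn).subset fun i hi => ⟨c i, hc i, ?_⟩
  rw [heq]
  exact Set.mul_mem_mul (hh i) ⟨t i, ⟨ht i, (not_le.1 hi).le⟩, rfl⟩

theorem exists_orbitInf_eq (hι : Function.Injective ι) (hdisc : DiscreteTopology ι.range)
    (hcpt : ∀ R, IsCompact {h | ψ h ≤ R}) (hbdd : BddBelow (Set.range ψ)) (h : G) :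
    ∃ γ, orbitInf ι ψ h = ψ (ι γ * h) := by
  have hfin : {γ | ψ (ι γ * h) ≤ ψ h}.Finite :=
    (finite_setOf_map_mul_mem_isCompact hι hdisc isCompact_singleton (hcpt (ψ h))).subset
      fun γ hγ => ⟨h, rfl, hγ⟩
  obtain ⟨γ, hγ, hmin⟩ := Set.exists_min_image _ (fun γ => ψ (ι γ * h)) hfin ⟨1, by simp⟩
  refine ⟨γ, le_antisymm (orbitInf_le hbdd h γ) (le_ciInf fun α => ?_)⟩
  rcases le_total (ψ (ι α * h)) (ψ h) with hα | hα
  · exact hmin α hα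
  · exact le_trans hγ hα

theorem continuous_orbitInf (hι : Function.Injective ι) (hdisc : DiscreteTopology ι.range)
    (hψ : Continuous ψ) (hcpt : ∀ R, IsCompact {h | ψ h ≤ R}) (hbdd : BddBelow (Set.range ψ)) :
    Continuous (orbitInf ι ψ) := by
  refine continuous_iff_continuousAt.2 fun h₀ => ?_
  set R := ψ h₀ + 1
  have hfin := finite_setOf_map_mul_mem_isCompact hι hdisc (hcpt R) (hcpt R)
  have hone : 1 ∈ hfin.toFinset := by simpa using ⟨h₀, by simp [R]⟩
  have hc : Continuous fun h => hfin.toFinset.inf' ⟨1, hone⟩ fun γ => ψ (ι γ * h) :=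
    Continuous.finset_inf'_apply _ fun γ _ => hψ.comp (continuous_const_mul _)
  refine hc.continuousAt.congr ?_
  filter_upwards [hψ.continuousAt.eventually_lt continuousAt_const (lt_add_one (ψ h₀))] with h hh
  refine le_antisymm ?_ (Finset.le_inf' _ _ fun γ _ => orbitInf_le hbdd h γ)
  obtain ⟨γ, hγ⟩ := exists_orbitInf_eq hι hdisc hcpt hbdd h
  rw [hγ]
  refine Finset.inf'_le (fun γ => ψ (ι γ * h)) (hfin.mem_toFinset.2 ⟨h, hh.le, ?_⟩)
  calc ψ (ι γ * h) = orbitInf ι ψ h := hγ.symm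
    _ ≤ ψ h := orbitInf_le_self hbdd h
    _ ≤ R := hh.le

theorem exists_locallyFinite_cutoff (hι : Function.Injective ι) (hdisc : DiscreteTopology ι.range)
    (hψ : Continuous ψ) (hcpt : ∀ R, IsCompact {h | ψ h ≤ R}) (hbdd : BddBelow (Set.range ψ)) :
    ∃ χ : G → NNReal, Continuous χ ∧ (∀ h, ∃ γ, χ (ι γ * h) ≠ 0) ∧
      LocallyFinite fun γ => Function.support fun h => χ (ι γ * h) := by
  refine ⟨fun h => Real.toNNReal (1 + orbitInf ι ψ h - ψ h), continuous_real_toNNReal.comp <|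
    ((continuous_orbitInf hι hdisc hψ hcpt hbdd).const_add 1).sub hψ, fun h => ?_, fun h₀ => ?_⟩
  · obtain ⟨γ, hγ⟩ := exists_orbitInf_eq hι hdisc hcpt hbdd h
    exact ⟨γ, by simp [orbitInf_map_mul, hγ]⟩
  · set R := ψ h₀ + 1
    refine ⟨{h | ψ h < R}, hψ.continuousAt.eventually_lt continuousAt_const (lt_add_one _), ?_⟩
    refine (finite_setOf_map_mul_mem_isCompact hι hdisc (hcpt R) (hcpt (1 + R))).subset ?_
    rintro γ ⟨h, hγ, hh : ψ h < R⟩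
    have hpos : 0 < 1 + orbitInf ι ψ h - ψ (ι γ * h) := by
      simpa [orbitInf_map_mul, Real.toNNReal_eq_zero] using hγ
    have hle : orbitInf ι ψ h ≤ ψ h := orbitInf_le_self hbdd h
    exact ⟨h, hh.le, show ψ (ι γ * h) ≤ 1 + R by linarith⟩

end DiscreteSubgroup

/-! ### Vertical norms -/

section TangentNorms

theorem cross_eq_zero_iff {K : Type*} [Field K] {u : Fin 3 → K} (hu : u ≠ 0) (v : Fin 3 → K) :
    v ⨯₃ u = 0 ↔ ∃ c : K, c • u = v := by
  rw [← not_iff_not, ← cross_anticomm, neg_eq_zero, ← ne_eq,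
    crossProduct_ne_zero_iff_linearIndependent, LinearIndependent.pair_iff' hu, not_exists]

theorem preservesLine_conj (g : SL(3, ℝ)) (A : Mat3) (p : P2) :
    PreservesLine (g.1 * A * (g⁻¹).1) (g • p) ↔ PreservesLine A p := by
  have hinv : (g⁻¹).1 * g.1 = 1 := congrArg Subtype.val (inv_mul_cancel g)
  have hinj : Function.Injective (g.1 *ᵥ ·) :=
    Function.LeftInverse.injective (g := ((g⁻¹).1 *ᵥ ·)) fun v =>
      (Matrix.mulVec_mulVec _ _ _).trans (by rw [hinv, Matrix.one_mulVec])
  rw [((represents_rep p).mulVec g).preservesLine_iff, (represents_rep p).preservesLine_iff]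
  refine exists_congr fun c => ?_
  rw [Matrix.mulVec_mulVec, mul_assoc, hinv, mul_one, ← Matrix.mulVec_mulVec, ← Matrix.mulVec_smul]
  exact hinj.eq_iff

theorem fixesFrame_conj (g : SL(3, ℝ)) (A : Mat3) (y : Frame) :
    FixesFrame (g.1 * A * (g⁻¹).1) (g • y) ↔ FixesFrame A y :=
  forall_congr' fun j => preservesLine_conj g A (y.1 j)

/-- A norm on the tangent space of the projective plane at `p`, as a seminorm on `gl(V)`: the size
of the component of `A u` transverse to a representative `u` of `p`, relative to `u`. -/
def pointSeminorm (p : P2) : Seminorm ℝ Mat3 :=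
  Seminorm.of (fun A => ‖(A *ᵥ p.rep) ⨯₃ p.rep‖ / ‖p.rep‖ ^ 2)
    (fun A B => by
      rw [Matrix.add_mulVec, map_add, LinearMap.add_apply, ← add_div]
      gcongr
      exact norm_add_le _ _)
    (fun c A => by
      rw [Matrix.smul_mulVec, map_smul, LinearMap.smul_apply, norm_smul, mul_div_assoc])

theorem Represents.pointSeminorm_eq {u : Fin 3 → ℝ} {p : P2} (hu : Represents u p) (A : Mat3) :
    pointSeminorm p A = ‖(A *ᵥ u) ⨯₃ u‖ / ‖u‖ ^ 2 := by
  obtain ⟨d, hd, rfl⟩ := (represents_rep p).exists_eq_smul hu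
  change ‖(A *ᵥ p.rep) ⨯₃ p.rep‖ / ‖p.rep‖ ^ 2 = _
  have hd' : ‖d‖ ≠ 0 := norm_ne_zero_iff.2 hd
  rw [Matrix.mulVec_smul, map_smul, map_smul, LinearMap.smul_apply, smul_smul, norm_smul,
    norm_smul, norm_mul]
  field_simp

theorem pointSeminorm_eq_zero_iff (p : P2) (A : Mat3) :
    pointSeminorm p A = 0 ↔ PreservesLine A p := by
  have hp : ‖p.rep‖ ^ 2 ≠ 0 := pow_ne_zero 2 (norm_ne_zero_iff.2 p.rep_nonzero)
  rw [(represents_rep p).pointSeminorm_eq, (represents_rep p).preservesLine_iff,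
    ← cross_eq_zero_iff p.rep_nonzero, div_eq_zero_iff, or_iff_left hp, norm_eq_zero]

theorem continuous_pointSeminorm : Continuous fun x : P2 × Mat3 => pointSeminorm x.1 x.2 := by
  refine continuous_iff_ultrafilter.2 fun x l h => ?_
  obtain ⟨u, u₀, hu, hu₀, hlim⟩ := exists_represents_tendsto (p := Prod.fst) l
    ((continuous_fst.tendsto x).mono_left h)
  have hA : Tendsto (fun x : P2 × Mat3 => x.2) l (𝓝 x.2) :=
    (continuous_snd.tendsto x).mono_left h
  have hcross : Continuous fun q : Mat3 × (Fin 3 → ℝ) => (q.1 *ᵥ q.2) ⨯₃ q.2 := by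
    simp only [cross_apply]
    fun_prop
  rw [hu₀.pointSeminorm_eq]
  simp only [fun x : P2 × Mat3 => (hu x).pointSeminorm_eq]
  exact ((hcross.tendsto (x.2, u₀)).comp (hA.prodMk_nhds hlim)).norm.div (hlim.norm.pow 2)
    (pow_ne_zero 2 (norm_ne_zero_iff.2 hu₀.1))

/-- A norm on the tangent space of the frame variety at `y`, as a seminorm on `gl(V)`. -/
def frameSeminorm (y : Frame) : Seminorm ℝ Mat3 := ∑ j, pointSeminorm (y.1 j)

theorem frameSeminorm_apply (y : Frame) (A : Mat3) :
    frameSeminorm y A = ∑ j, pointSeminorm (y.1 j) A :=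
  sum_apply _ _ _

theorem frameSeminorm_eq_zero_iff (y : Frame) (A : Mat3) :
    frameSeminorm y A = 0 ↔ FixesFrame A y := by
  rw [frameSeminorm_apply, Finset.sum_eq_zero_iff_of_nonneg fun j _ => apply_nonneg _ _]
  simp only [Finset.mem_univ, true_imp_iff, pointSeminorm_eq_zero_iff, FixesFrame]

theorem continuous_frameSeminorm : Continuous fun x : Frame × Mat3 => frameSeminorm x.1 x.2 := by
  simp only [frameSeminorm_apply]
  refine continuous_finsetSum _ fun j _ => ?_
  have hpt : Continuous fun x : Frame × Mat3 => (x.1.1 j, x.2) :=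
    (((continuous_apply j).comp continuous_subtype_val).comp continuous_fst).prodMk continuous_snd
  exact (continuous_pointSeminorm.comp hpt :)

instance : ContinuousConstSMul SL(3, ℝ) P2 where
  continuous_const_smul g := continuous_iff_ultrafilter.2 fun p l h => by
    obtain ⟨u, u₀, hu, hu₀, hlim⟩ := exists_represents_tendsto (p := id) l h
    have hg : Continuous fun v : Fin 3 → ℝ => g.1 *ᵥ v := by fun_prop
    exact Represents.tendsto (fun i => (hu i).mulVec g) (hu₀.mulVec g) ((hg.tendsto u₀).comp hlim)

instance : ContinuousConstSMul SL(3, ℝ) Frame where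
  continuous_const_smul g := Continuous.subtype_mk (continuous_pi fun j =>
    ((continuous_apply j).comp continuous_subtype_val).const_smul g) _

end TangentNorms

section VerticalNorms

variable {Γ : Type*} [Group Γ] (ι : Γ →* SL(2, ℝ)) (ρ : Γ →* SL(3, ℝ)) (χ : SL(2, ℝ) → NNReal)

/-- The norm over `(h, y)` obtained by transporting `frameSeminorm` to `(h, y)` from all its
translates `(ι(γ) h, ρ(γ) y)` and summing with the weights `χ (ι(γ) h)`. -/
def averagedSeminorm (h : SL(2, ℝ)) (y : Frame) : Seminorm ℝ Mat3 :=
  ∑ᶠ γ : Γ, χ (ι γ * h) •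
    (frameSeminorm (ρ γ • y)).comp (LinearMap.mulLeftRight ℝ ((ρ γ).1, ((ρ γ)⁻¹).1))

variable {ι χ}

theorem averagedSeminorm_apply {h : SL(2, ℝ)}
    (hfin : (Function.support fun γ => χ (ι γ * h)).Finite) (y : Frame) (A : Mat3) :
    averagedSeminorm ι ρ χ h y A =
      ∑ᶠ γ : Γ, χ (ι γ * h) * frameSeminorm (ρ γ • y) ((ρ γ).1 * A * ((ρ γ)⁻¹).1) := by
  let evalAt : Seminorm ℝ Mat3 →+ ℝ :=
    (Pi.evalAddMonoidHom (fun _ => ℝ) A).comp (FunLike.coeAddMonoidHom (Seminorm ℝ Mat3) Mat3 ℝ)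
  exact evalAt.map_finsum <| hfin.subset <| Function.support_smul_subset_left
    (fun γ => χ (ι γ * h)) fun γ : Γ =>
      (frameSeminorm (ρ γ • y)).comp (LinearMap.mulLeftRight ℝ ((ρ γ).1, ((ρ γ)⁻¹).1))

theorem averagedSeminorm_eq_zero_iff {h : SL(2, ℝ)}
    (hfin : (Function.support fun γ => χ (ι γ * h)).Finite) (hne : ∃ γ, χ (ι γ * h) ≠ 0)
    (y : Frame) (A : Mat3) : averagedSeminorm ι ρ χ h y A = 0 ↔ FixesFrame A y := by
  have hzero (γ : Γ) : frameSeminorm (ρ γ • y) ((ρ γ).1 * A * ((ρ γ)⁻¹).1) = 0 ↔ FixesFrame A y :=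
    (frameSeminorm_eq_zero_iff _ _).trans (fixesFrame_conj (ρ γ) A y)
  rw [averagedSeminorm_apply ρ hfin]
  refine ⟨fun hsum => ?_, fun hA => finsum_eq_zero_of_forall_eq_zero fun γ => ?_⟩
  · obtain ⟨γ, hγ⟩ := hne
    have hnonneg (γ : Γ) :
        0 ≤ χ (ι γ * h) * frameSeminorm (ρ γ • y) ((ρ γ).1 * A * ((ρ γ)⁻¹).1) :=
      mul_nonneg (χ _).2 (apply_nonneg _ _)
    have hfin' := hfin.subset <| (Function.support_mul_subset_left (fun γ => (χ (ι γ * h) : ℝ))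
      fun γ => frameSeminorm (ρ γ • y) ((ρ γ).1 * A * ((ρ γ)⁻¹).1)).trans (by simp)
    have hle := (single_le_finsum γ hfin' hnonneg).trans_eq hsum
    exact (hzero γ).1 <| (mul_eq_zero.1 (hle.antisymm (hnonneg γ))).resolve_left
      (NNReal.coe_ne_zero.2 hγ)
  · rw [(hzero γ).2 hA, mul_zero]

theorem continuous_averagedSeminorm (hχ : Continuous χ)
    (hloc : LocallyFinite fun γ : Γ => Function.support fun h => χ (ι γ * h)) :
    Continuous fun x : SL(2, ℝ) × Frame × Mat3 => averagedSeminorm ι ρ χ x.1 x.2.1 x.2.2 := by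
  simp only [fun h => averagedSeminorm_apply ρ (hloc.point_finite h)]
  refine continuous_finsum (fun γ => ?_) <|
    (hloc.preimage_continuous continuous_fst).subset fun γ x hx => ?_
  · have hweight : Continuous fun x : SL(2, ℝ) × Frame × Mat3 => (χ (ι γ * x.1) : ℝ) := by fun_prop
    have hconj : Continuous fun x : SL(2, ℝ) × Frame × Mat3 =>
      (ρ γ • x.2.1, (ρ γ).1 * x.2.2 * ((ρ γ)⁻¹).1) := by fun_prop
    have hnorm := continuous_frameSeminorm.comp hconj
    exact (hweight.mul hnorm :)
  · exact NNReal.coe_ne_zero.1 (left_ne_zero_of_mul hx)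

theorem averagedSeminorm_smul (hfin : ∀ h, (Function.support fun γ => χ (ι γ * h)).Finite) (α : Γ)
    (h : SL(2, ℝ)) (y : Frame) (A : Mat3) :
    averagedSeminorm ι ρ χ (ι α * h) (ρ α • y) ((ρ α).1 * A * ((ρ α)⁻¹).1) =
      averagedSeminorm ι ρ χ h y A := by
  rw [averagedSeminorm_apply ρ (hfin _), averagedSeminorm_apply ρ (hfin h)]
  refine (finsum_congr fun γ => ?_).trans (finsum_comp_equiv (Equiv.mulRight α))
  simp only [Equiv.coe_mulRight, map_mul, mul_inv_rev, mul_smul, mul_assoc,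
    Matrix.SpecialLinearGroup.coe_mul]

theorem nonempty_verticalNorm (hι : Function.Injective ι) (hdisc : DiscreteTopology ι.range) :
    Nonempty (VerticalNorm ι ρ) := by
  obtain ⟨χ, hχ, hne, hloc⟩ := exists_locallyFinite_cutoff hι hdisc continuous_frobeniusSq
    isCompact_frobeniusSq_le bddBelow_range_frobeniusSq
  exact ⟨{
    norm := averagedSeminorm ι ρ χ
    norm_eq_zero_iff h := averagedSeminorm_eq_zero_iff ρ (hloc.point_finite h) (hne h)
    continuous_norm := continuous_averagedSeminorm ρ hχ hloc
    norm_smul := averagedSeminorm_smul ρ hloc.point_finite }⟩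

/-- The vertical norm obtained by rescaling a vertical norm by a positive function on `M`, given by
its lift `φ` to `H`. -/
def VerticalNorm.rescale {ρ : Γ →* SL(3, ℝ)} (N : VerticalNorm ι ρ) {φ : SL(2, ℝ) → ℝ}
    (hφ : Continuous φ) (hpos : ∀ h, 0 < φ h) (hinv : ∀ γ h, φ (ι γ * h) = φ h) :
    VerticalNorm ι ρ where
  norm h y := NNReal.mk (φ h) (hpos h).le • N.norm h y
  norm_eq_zero_iff h y A := (mul_eq_zero_iff_left (hpos h).ne').trans (N.norm_eq_zero_iff h y A)
  continuous_norm := (hφ.comp continuous_fst).mul N.continuous_norm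
  norm_smul γ h y A := congrArg₂ (· * ·) (hinv γ h) (N.norm_smul γ h y A)

end VerticalNorms

/-! ### Cocompactness -/

theorem exists_continuous_pos_ge (c : ℕ → ℝ) :
    ∃ F : C(ℝ, ℝ), ∀ s, 0 < F s ∧ ∀ n : ℕ, n ≤ s → c n ≤ F s := by
  refine exists_continuous_forall_mem_convex_of_local_const
    (t := fun s : ℝ => {x | 0 < x ∧ ∀ n : ℕ, n ≤ s → c n ≤ x}) (fun s => ?_) fun s => ?_
  · exact Set.OrdConnected.convex
      ⟨fun x hx _ _ z hz => ⟨hx.1.trans_le hz.1, fun n hn => (hx.2 n hn).trans hz.1⟩⟩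
  · let bound : ℝ := ∑ n ∈ Finset.range (⌊s + 1⌋₊ + 1), |c n|
    have hbound : 0 ≤ bound := Finset.sum_nonneg fun n _ => abs_nonneg _
    refine ⟨bound + 1, (eventually_lt_nhds (lt_add_one s)).mono fun r hr =>
      ⟨by linarith, fun n hn => ?_⟩⟩
    have hmem : n ∈ Finset.range (⌊s + 1⌋₊ + 1) :=
      Finset.mem_range_succ_iff.2 (Nat.le_floor (hn.trans hr.le))
    have hle : |c n| ≤ bound := Finset.single_le_sum (fun n _ => abs_nonneg (c n)) hmem
    linarith [le_abs_self (c n)]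

section Cocompact

variable {Γ : Type*} [Group Γ] {ι : Γ →* SL(2, ℝ)}

theorem orbitInf_frobeniusSq_mul_diagFlow_le (h : SL(2, ℝ)) {t : ℝ} (ht : 0 ≤ t) :
    orbitInf ι frobeniusSq (h * diagFlow t) ≤ Real.exp (2 * t) * orbitInf ι frobeniusSq h := by
  rw [orbitInf, orbitInf, Real.mul_iInf_of_nonneg (Real.exp_pos _).le]
  refine ciInf_mono (bddBelow_range_frobeniusSq.mono <| Set.range_comp_subset_range
    (fun γ => ι γ * (h * diagFlow t)) frobeniusSq) fun γ => ?_
  rw [← mul_assoc]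
  exact frobeniusSq_mul_diagFlow_le _ ht

theorem exists_exp_le_orbitInf (hι : Function.Injective ι) (hdisc : DiscreteTopology ι.range)
    (h : SL(2, ℝ)) : ∃ θ t, frobeniusSq (diagFlow t) = orbitInf ι frobeniusSq h ∧ 0 ≤ t ∧
      ∀ s ≤ t, Real.exp (2 * s) ≤ orbitInf ι frobeniusSq (rotation θ * diagFlow s) := by
  obtain ⟨γ, hγ⟩ := exists_orbitInf_eq hι hdisc isCompact_frobeniusSq_le
    bddBelow_range_frobeniusSq h
  obtain ⟨θ, θ', t, ht, hcartan⟩ := exists_mul_rotation_eq_rotation_mul_diagFlow (ι γ * h)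
  have hright := frobeniusSq_mul_right (transpose_rotation_mul_rotation θ')
  have hfrob : frobeniusSq (diagFlow t) = orbitInf ι frobeniusSq h := by
    rw [hγ, ← hright (ι γ * h), hcartan, frobeniusSq_mul_left (transpose_rotation_mul_rotation θ)]
  have horbit : orbitInf ι frobeniusSq (rotation θ * diagFlow t) = frobeniusSq (diagFlow t) := by
    rw [← hcartan, orbitInf_mul_right hright, orbitInf_map_mul, hfrob]
  refine ⟨θ, t, hfrob, ht, fun s hs => ?_⟩
  have hle : Real.exp (2 * (t - s)) * Real.exp (2 * s) ≤
      Real.exp (2 * (t - s)) * orbitInf ι frobeniusSq (rotation θ * diagFlow s) := calc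
    _ = Real.exp (2 * t) := by rw [← Real.exp_add, ← mul_add, sub_add_cancel]
    _ ≤ frobeniusSq (diagFlow t) := by
      rw [frobeniusSq_diagFlow]
      exact le_add_of_nonneg_right (Real.exp_pos _).le
    _ = orbitInf ι frobeniusSq (rotation θ * diagFlow s * diagFlow (t - s)) := by
      rw [mul_assoc, ← diagFlow_add, add_sub_cancel, horbit]
    _ ≤ _ := orbitInf_frobeniusSq_mul_diagFlow_le _ (sub_nonneg.2 hs)
  exact le_of_mul_le_mul_left hle (Real.exp_pos _)

theorem exists_ray_exp_le_orbitInf (hι : Function.Injective ι) (hdisc : DiscreteTopology ι.range)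
    (hunb : ∀ R : ℝ, ∃ h, R < orbitInf ι frobeniusSq h) :
    ∃ k, ∀ s, Real.exp (2 * s) ≤ orbitInf ι frobeniusSq (k * diagFlow s) := by
  have hcont : Continuous (orbitInf ι frobeniusSq) := continuous_orbitInf hι hdisc
    continuous_frobeniusSq isCompact_frobeniusSq_le bddBelow_range_frobeniusSq
  obtain ⟨k, -, hk⟩ := isCompact_range_rotation.inter_iInter_nonempty
    (fun s : ℝ => {k | Real.exp (2 * s) ≤ orbitInf ι frobeniusSq (k * diagFlow s)})
    (fun s => isClosed_le continuous_const (hcont.comp (continuous_mul_const _))) fun u => by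
      obtain ⟨M, hM⟩ := u.exists_le
      obtain ⟨h, hh⟩ := hunb (Real.exp (2 * M) + 1)
      obtain ⟨θ, t, hfrob, ht, hray⟩ := exists_exp_le_orbitInf hι hdisc h
      have hMt : M ≤ t := by
        have hexp : Real.exp (-(2 * t)) ≤ 1 := Real.exp_le_one_iff.2 (by linarith)
        rw [← hfrob, frobeniusSq_diagFlow] at hh
        have : Real.exp (2 * M) < Real.exp (2 * t) := by linarith
        linarith [Real.exp_lt_exp.1 this]
      exact ⟨_, ⟨θ, rfl⟩, Set.mem_iInter₂.2 fun s hs => hray s ((hM s hs).trans hMt)⟩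
  exact ⟨k, fun s => Set.mem_iInter.1 hk s⟩

variable {ρ : Γ →* SL(3, ℝ)} {f : SL(2, ℝ) → Frame}

theorem IsAnosovStructure.not_forall_natCast_le (hf : IsAnosovStructure ι ρ f)
    (hι : Function.Injective ι) (hdisc : DiscreteTopology ι.range) {φ : SL(2, ℝ) → ℝ}
    (hφ : Continuous φ) (hinv : ∀ γ h, φ (ι γ * h) = φ h) (k : SL(2, ℝ)) :
    ¬ ∀ n : ℕ, n ≤ φ (k * diagFlow n) := by
  intro hk
  obtain ⟨N₀⟩ := nonempty_verticalNorm ρ hι hdisc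
  obtain ⟨P, hP⟩ := exists_representsFrame (f k)
  let A := rootMatrix 0 1 P
  have hA (h : SL(2, ℝ)) : 0 < N₀.norm h (f k) A := (apply_nonneg _ _).lt_of_ne' fun h0 =>
    hP.not_fixesFrame_rootMatrix (by decide) ((N₀.norm_eq_zero_iff _ _ _).1 h0)
  -- `F` grows fast enough to keep the contraction from shrinking `A` along the ray.
  obtain ⟨F, hF⟩ := exists_continuous_pos_ge fun n => (N₀.norm (k * diagFlow n) (f k) A)⁻¹
  let N := N₀.rescale (F.continuous.comp hφ) (fun h => (hF (φ h)).1)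
    fun γ h => congrArg F (hinv γ h)
  obtain ⟨a, b, ha, -, hcontr⟩ := hf.hyperbolic N
  have hone (n : ℕ) : 1 ≤ N.norm (k * diagFlow n) (f k) A := by
    have h := mul_le_mul_of_nonneg_right ((hF _).2 n (hk n)) (hA (k * diagFlow n)).le
    rwa [inv_mul_cancel₀ (hA _).ne'] at h
  have hbound : ∀ᶠ n : ℕ in atTop, 1 ≤ b * Real.exp (-a * n) * N.norm k (f k) A := by
    filter_upwards [eventually_gt_atTop 0] with n hn
    exact (hone n).trans <|
      (hcontr k n (Nat.cast_pos.2 hn) A).1 (hP.fixesFlag_rootMatrix (by decide))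
  have hlim : Tendsto (fun n : ℕ => b * Real.exp (-a * n) * N.norm k (f k) A) atTop
      (𝓝 (b * 0 * N.norm k (f k) A)) :=
    ((Real.tendsto_exp_atBot.comp (tendsto_natCast_atTop_atTop.const_mul_atTop_of_neg
      (neg_lt_zero.2 ha))).const_mul b).mul_const _
  have := ge_of_tendsto hlim hbound
  norm_num at this

theorem IsAnosovStructure.exists_frobeniusSq_le (hf : IsAnosovStructure ι ρ f)
    (hι : Function.Injective ι) (hdisc : DiscreteTopology ι.range) :
    ∃ R, ∀ h, ∃ γ, frobeniusSq (ι γ * h) ≤ R := by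
  by_contra! hunb
  have hmin := exists_orbitInf_eq hι hdisc isCompact_frobeniusSq_le bddBelow_range_frobeniusSq
  obtain ⟨k, hk⟩ := exists_ray_exp_le_orbitInf hι hdisc fun R => by
    obtain ⟨h, hh⟩ := hunb R
    obtain ⟨γ, hγ⟩ := hmin h
    exact ⟨h, hγ ▸ hh γ⟩
  refine hf.not_forall_natCast_le hι hdisc (continuous_orbitInf hι hdisc continuous_frobeniusSq
    isCompact_frobeniusSq_le bddBelow_range_frobeniusSq) orbitInf_map_mul k fun n => ?_
  have hexp := (Real.add_one_le_exp (2 * (n : ℝ))).trans (hk n)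
  linarith [(n.cast_nonneg : (0 : ℝ) ≤ n)]

end Cocompact

section Dynamics

variable {Γ : Type*} [Group Γ] {ι : Γ →* SL(2, ℝ)} {ρ : Γ →* SL(3, ℝ)} {f : SL(2, ℝ) → Frame}

/-! ### Dynamics of Anosov representations -/

theorem IsAnosovStructure.norm_conj (hf : IsAnosovStructure ι ρ f) (N : VerticalNorm ι ρ) {γ : Γ}
    {c h : SL(2, ℝ)} {t : ℝ} (hγ : ι γ * c = h * diagFlow t) (A : Mat3) :
    N.norm (h * diagFlow t) (f h) ((ρ γ).1 * A * ((ρ γ)⁻¹).1) = N.norm c (f c) A := by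
  rw [← hf.flow_invariant h t, ← hγ, hf.equivariant, N.norm_smul]

theorem IsAnosovStructure.smul_eq (hf : IsAnosovStructure ι ρ f) {γ : Γ} {c h : SL(2, ℝ)} {t : ℝ}
    (hγ : ι γ * c = h * diagFlow t) : ρ γ • f c = f h := by
  rw [← hf.equivariant, hγ, hf.flow_invariant]

variable {I : Type*} {γ : I → Γ} {c h : I → SL(2, ℝ)} {c₀ h₀ : SL(2, ℝ)} {t : I → ℝ}

theorem IsAnosovStructure.tendsto_div_of_lt (hf : IsAnosovStructure ι ρ f)
    (hι : Function.Injective ι) (hdisc : DiscreteTopology ι.range) {l : Filter I}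
    (hγ : ∀ i, ι (γ i) * c i = h i * diagFlow (t i)) (hc : Tendsto c l (𝓝 c₀))
    (hh : Tendsto h l (𝓝 h₀)) (ht : Tendsto t l atTop) {P Q : I → Mat3} {P₀ Q₀ : Mat3}
    {d : I → Fin 3 → ℝ} (hP : ∀ i, RepresentsFrame (P i) (f (h i)))
    (hQ : ∀ i, RepresentsFrame (Q i) (f (c i))) (hP₀ : RepresentsFrame P₀ (f h₀))
    (hQ₀ : RepresentsFrame Q₀ (f c₀)) (hPlim : Tendsto P l (𝓝 P₀)) (hQlim : Tendsto Q l (𝓝 Q₀))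
    (hd : ∀ i j, d i j ≠ 0) (hg : ∀ i, (ρ (γ i)).1 = P i * Matrix.diagonal (d i) * (Q i)⁻¹)
    {j k : Fin 3} (hjk : j < k) : Tendsto (fun i => d i k / d i j) l (𝓝 0) := by
  obtain ⟨N⟩ := nonempty_verticalNorm ρ hι hdisc
  obtain ⟨a, b, ha, -, hcontr⟩ := hf.hyperbolic N
  have hN {x : I → SL(2, ℝ)} {x₀ : SL(2, ℝ)} {B : I → Mat3} {B₀ : Mat3} (hx : Tendsto x l (𝓝 x₀))
      (hB : Tendsto B l (𝓝 B₀)) :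
      Tendsto (fun i => N.norm (x i) (f (x i)) (B i)) l (𝓝 (N.norm x₀ (f x₀) B₀)) :=
    (N.continuous_norm.tendsto (x₀, f x₀, B₀)).comp
      (hx.prodMk_nhds (((hf.continuous.tendsto x₀).comp hx).prodMk_nhds hB))
  have hnum := hN hh (tendsto_rootMatrix hPlim hP₀.isUnit_det j k)
  have hden := hN hc (tendsto_rootMatrix hQlim hQ₀.isUnit_det j k)
  have hpos : 0 < N.norm c₀ (f c₀) (rootMatrix j k Q₀) :=
    (apply_nonneg _ _).lt_of_ne' fun h0 =>
      hQ₀.not_fixesFrame_rootMatrix hjk.ne ((N.norm_eq_zero_iff _ _ _).1 h0)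
  have hexp : Tendsto (fun i => b * Real.exp (-a * t i)) l (𝓝 (b * 0)) :=
    (Real.tendsto_exp_atBot.comp (ht.const_mul_atTop_of_neg (neg_lt_zero.2 ha))).const_mul b
  have hlim := (hexp.mul hnum).div hden hpos.ne'
  rw [mul_zero, zero_mul, zero_div] at hlim
  refine squeeze_zero_norm' ?_ hlim
  filter_upwards [ht.eventually_gt_atTop 0, hden.eventually (lt_mem_nhds hpos)] with i hti hNi
  have hnorm := hf.norm_conj N (hγ i) (rootMatrix j k (Q i))
  rw [conj_rootMatrix (hg i) (hP i).isUnit_det (hQ i).isUnit_det (hd i), map_smul_eq_mul] at hnorm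
  have hE := (hcontr (h i) (t i) hti _).1 ((hP i).fixesFlag_rootMatrix hjk)
  rw [Pi.div_apply, le_div_iff₀ hNi, ← hnorm, ← mul_assoc, ← norm_mul,
    div_mul_div_cancel₀' (hd i k), div_self (hd i j), norm_one, one_mul]
  exact hE

theorem IsAnosovStructure.attracts (hf : IsAnosovStructure ι ρ f) (hι : Function.Injective ι)
    (hdisc : DiscreteTopology ι.range) {l : Ultrafilter I}
    (hγ : ∀ i, ι (γ i) * c i = h i * diagFlow (t i)) (hc : Tendsto c l (𝓝 c₀))
    (hh : Tendsto h l (𝓝 h₀)) (ht : Tendsto t l atTop) :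
    Attracts l (fun i => ρ (γ i)) (piPlus (f h₀)) (piMinus (f c₀)) ∧
      Attracts l (fun i => (ρ (γ i))⁻¹) (piMinus (f c₀)) (piPlus (f h₀)) := by
  obtain ⟨P, P₀, hP, hP₀, hPlim⟩ :=
    exists_representsFrame_tendsto l ((hf.continuous.tendsto h₀).comp hh)
  obtain ⟨Q, Q₀, hQ, hQ₀, hQlim⟩ :=
    exists_representsFrame_tendsto l ((hf.continuous.tendsto c₀).comp hc)
  choose d hd hg using fun i =>
    exists_eq_mul_diagonal_mul_inv (hP i) (hQ i) (hf.smul_eq (hγ i))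
  exact attracts_of_eq_mul_diagonal_mul_inv hg (fun i => (hP i).isUnit_det)
    (fun i => (hQ i).isUnit_det) hd
    (fun _ _ => hf.tendsto_div_of_lt hι hdisc hγ hc hh ht hP hQ hP₀ hQ₀ hPlim hQlim hd hg)
    hPlim hQlim hP₀ hQ₀

/-! ### The limit curve -/

theorem tendsto_natCast_hyperfilter :
    Tendsto (fun n : ℕ => (n : ℝ)) (hyperfilter ℕ : Filter ℕ) atTop :=
  tendsto_natCast_atTop_atTop.mono_left Nat.hyperfilter_le_atTop

theorem IsAnosovStructure.exists_map_mul_tendsto (hf : IsAnosovStructure ι ρ f)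
    (hι : Function.Injective ι) (hdisc : DiscreteTopology ι.range) (l : Ultrafilter I)
    (h : I → SL(2, ℝ)) :
    ∃ (γ : I → Γ) (c₀ : SL(2, ℝ)), Tendsto (fun i => ι (γ i) * h i) l (𝓝 c₀) := by
  obtain ⟨R, hR⟩ := hf.exists_frobeniusSq_le hι hdisc
  choose γ hγ using fun i => hR (h i)
  obtain ⟨c₀, -, hc₀⟩ := exists_tendsto_of_mem_isCompact (isCompact_frobeniusSq_le R) l hγ
  exact ⟨γ, c₀, hc₀⟩

theorem IsAnosovStructure.piPlus_mul_upper (hf : IsAnosovStructure ι ρ f)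
    (hι : Function.Injective ι) (hdisc : DiscreteTopology ι.range) (h : SL(2, ℝ))
    {b : SL(2, ℝ)} (hb : b 1 0 = 0) : piPlus (f (h * b)) = piPlus (f h) := by
  obtain ⟨γ, c₀, hc⟩ := hf.exists_map_mul_tendsto hι hdisc (hyperfilter ℕ)
    fun n => h * diagFlow n
  obtain ⟨b₀, hb₀⟩ := exists_tendsto_diagFlow_conj hb
  have hconj := hb₀.comp tendsto_natCast_hyperfilter
  have hflow (n : ℕ) : h * diagFlow n * (diagFlow (-n) * b * diagFlow n) = h * b * diagFlow n := by
    have hcancel : diagFlow (n : ℝ) * diagFlow (-n) = 1 := by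
      rw [← diagFlow_add, add_neg_cancel, diagFlow_zero]
    simp only [← mul_assoc]
    rw [mul_assoc h, hcancel, mul_one]
  have hatt := hf.attracts hι hdisc (γ := fun n => (γ n)⁻¹) (t := fun n : ℕ => (n : ℝ))
    (fun n => by rw [map_inv, inv_mul_cancel_left]) hc tendsto_const_nhds
    tendsto_natCast_hyperfilter
  have hatt' := hf.attracts hι hdisc (γ := fun n => (γ n)⁻¹) (h := fun _ => h * b)
    (t := fun n : ℕ => (n : ℝ)) (fun n => by
      rw [← hflow, map_inv, Function.comp_apply, mul_assoc (ι (γ n)), inv_mul_cancel_left])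
    (hc.mul hconj) tendsto_const_nhds tendsto_natCast_hyperfilter
  exact hatt'.1.unique hatt.1

theorem IsAnosovStructure.piPlus_mul_rotation_pi_div_two (hf : IsAnosovStructure ι ρ f)
    (hι : Function.Injective ι) (hdisc : DiscreteTopology ι.range) (h : SL(2, ℝ)) :
    piPlus (f (h * rotation (Real.pi / 2))) = piMinus (f h) := by
  obtain ⟨γ, c₀, hc⟩ := hf.exists_map_mul_tendsto hι hdisc (hyperfilter ℕ)
    fun n => h * diagFlow (-n)
  have hatt := hf.attracts hι hdisc (γ := γ) (c := fun _ => h) (t := fun n : ℕ => (n : ℝ))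
    (fun n => by
      rw [mul_assoc, mul_assoc, ← diagFlow_add, neg_add_cancel, diagFlow_zero, mul_one])
    tendsto_const_nhds hc tendsto_natCast_hyperfilter
  have hatt' := hf.attracts hι hdisc (γ := fun n => (γ n)⁻¹)
    (h := fun _ => h * rotation (Real.pi / 2)) (t := fun n : ℕ => (n : ℝ)) (fun n => by
      rw [map_inv, mul_assoc (ι (γ n)), inv_mul_cancel_left, mul_assoc,
        diagFlow_mul_rotation_pi_div_two, neg_neg, mul_assoc])
    (hc.mul_const (rotation (Real.pi / 2))) tendsto_const_nhds tendsto_natCast_hyperfilter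
  simp only [map_inv] at hatt'
  exact hatt'.1.unique hatt.2

theorem IsAnosovStructure.isCompact_limitCurve (hf : IsAnosovStructure ι ρ f)
    (hι : Function.Injective ι) (hdisc : DiscreteTopology ι.range) :
    IsCompact (limitCurve f) := by
  have heq : limitCurve f = (fun h => piPlus (f h)) '' Set.range rotation := by
    refine Set.Subset.antisymm ?_ (Set.image_subset_range _ _)
    rintro _ ⟨h, rfl⟩
    obtain ⟨θ, b, rfl, hb, -⟩ := exists_eq_rotation_mul_upper h
    exact ⟨_, ⟨θ, rfl⟩, (hf.piPlus_mul_upper hι hdisc _ hb).symm⟩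
  rw [heq]
  exact isCompact_range_rotation.image (continuous_piPlus.comp hf.continuous)

theorem IsAnosovStructure.isOpen_domainOmega (hf : IsAnosovStructure ι ρ f)
    (hι : Function.Injective ι) (hdisc : DiscreteTopology ι.range) : IsOpen (domainOmega f) :=
  have hcpt := hf.isCompact_limitCurve hι hdisc
  ((hcpt.image continuous_pt).isClosed.isOpen_compl.preimage continuous_pt).inter
    ((hcpt.image continuous_line).isClosed.isOpen_compl.preimage continuous_line)

/-! ### The action on the domain -/

theorem IsAnosovStructure.smul_mem_limitCurve (hf : IsAnosovStructure ι ρ f) (γ : Γ) {F : Flag}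
    (hF : F ∈ limitCurve f) : ρ γ • F ∈ limitCurve f := by
  obtain ⟨h, rfl⟩ := hF
  exact ⟨ι γ * h, (congrArg piPlus (hf.equivariant γ h)).trans (piPlus_smul _ _)⟩

theorem IsAnosovStructure.smul_mem_domainOmega (hf : IsAnosovStructure ι ρ f) (γ : Γ) {x : Flag}
    (hx : x ∈ domainOmega f) : ρ γ • x ∈ domainOmega f := by
  constructor
  · rintro ⟨F, hF, h⟩
    refine hx.1 ⟨_, hf.smul_mem_limitCurve γ⁻¹ hF, ?_⟩
    rw [Flag.smul_pt, h, ← Flag.smul_pt, map_inv, inv_smul_smul]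
  · rintro ⟨F, hF, h⟩
    refine hx.2 ⟨_, hf.smul_mem_limitCurve γ⁻¹ hF, ?_⟩
    rw [Flag.smul_line, h, ← Flag.smul_line, map_inv, inv_smul_smul]

theorem IsAnosovStructure.exists_attracts_of_injective (hf : IsAnosovStructure ι ρ f)
    (hι : Function.Injective ι) (hdisc : DiscreteTopology ι.range) {l : Ultrafilter I}
    (hl : (l : Filter I) ≤ cofinite) (hγ : Function.Injective γ) :
    ∃ F ∈ limitCurve f, ∃ F' ∈ limitCurve f, Attracts l (fun i => ρ (γ i)) F F' := by
  choose θ θ' t ht hcartan using fun i => exists_mul_rotation_eq_rotation_mul_diagFlow (ι (γ i))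
  obtain ⟨h₀, -, hh⟩ := exists_tendsto_of_mem_isCompact isCompact_range_rotation l
    fun i => Set.mem_range_self (θ i)
  obtain ⟨c₀, -, hc⟩ := exists_tendsto_of_mem_isCompact isCompact_range_rotation l
    fun i => Set.mem_range_self (θ' i)
  have htlim : Tendsto t cofinite atTop := tendsto_cofinite_atTop_of_map_mul_eq hι hdisc
    isCompact_range_rotation isCompact_range_rotation continuous_diagFlow hγ
    (fun i => Set.mem_range_self (θ' i)) (fun i => Set.mem_range_self (θ i)) ht hcartan
  exact ⟨_, ⟨h₀, rfl⟩, _, ⟨_, hf.piPlus_mul_rotation_pi_div_two hι hdisc c₀⟩,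
    (hf.attracts hι hdisc hcartan hc hh (htlim.mono_left hl)).1⟩

theorem IsAnosovStructure.finite_setOf_image_inter_nonempty (hf : IsAnosovStructure ι ρ f)
    (hι : Function.Injective ι) (hdisc : DiscreteTopology ι.range) {K K' : Set Flag}
    (hK : IsCompact K) (hK' : IsCompact K') (hKΩ : K ⊆ domainOmega f) (hKΩ' : K' ⊆ domainOmega f) :
    {γ : Γ | (((fun x => ρ γ • x) '' K) ∩ K').Nonempty}.Finite := by
  set S := {γ : Γ | (((fun x => ρ γ • x) '' K) ∩ K').Nonempty}
  by_contra hinf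
  have : Infinite S := Set.infinite_coe_iff.2 hinf
  have hmove (γ : S) : ∃ x ∈ K, ρ γ • x ∈ K' := by
    obtain ⟨_, ⟨x, hx, rfl⟩, hx'⟩ := γ.2
    exact ⟨x, hx, hx'⟩
  choose x hxK hxK' using hmove
  obtain ⟨x₀, hx₀, hxlim⟩ := exists_tendsto_of_mem_isCompact hK (hyperfilter S) hxK
  obtain ⟨x₁, hx₁, hxlim'⟩ := exists_tendsto_of_mem_isCompact hK' (hyperfilter S) hxK'
  obtain ⟨F, hF, F', hF', hatt⟩ := hf.exists_attracts_of_injective hι hdisc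
    (hyperfilter_le_cofinite (α := S)) Subtype.val_injective
  rcases hatt.pt_eq_or_line_eq hxlim hxlim' with (hpt | hline) | hpt | hline
  · exact (hKΩ hx₀).1 ⟨F', hF', hpt.symm⟩
  · exact (hKΩ hx₀).2 ⟨F', hF', hline.symm⟩
  · exact (hKΩ' hx₁).1 ⟨F, hF, hpt.symm⟩
  · exact (hKΩ' hx₁).2 ⟨F, hF, hline.symm⟩

theorem IsAnosovStructure.isOfFinOrder_of_smul_eq (hf : IsAnosovStructure ι ρ f)
    (hι : Function.Injective ι) (hdisc : DiscreteTopology ι.range) {γ : Γ} {x : Flag}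
    (hx : x ∈ domainOmega f) (hfix : ρ γ • x = x) : IsOfFinOrder γ := by
  have hxΩ : {x} ⊆ domainOmega f := Set.singleton_subset_iff.2 hx
  refine finite_powers.1 <| (hf.finite_setOf_image_inter_nonempty hι hdisc isCompact_singleton
    isCompact_singleton hxΩ hxΩ).subset ?_
  have hle : Submonoid.powers γ ≤ ((MulAction.stabilizer SL(3, ℝ) x).comap ρ).toSubmonoid :=
    Submonoid.powers_le.2 hfix
  exact fun α hα => ⟨x, ⟨x, rfl, hle hα⟩, rfl⟩

end Dynamics

end AnosovFlag

end

open scoped MatrixGroups in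
open AnosovFlag in
theorem mainTheorem1_general {Γ : Type*} [Group Γ] (ι : Γ →* SL(2, ℝ))
    (hι : Function.Injective ι) (hdisc : DiscreteTopology ι.range)
    (ρ : Γ →* SL(3, ℝ)) (f : SL(2, ℝ) → Frame) (hf : IsAnosovStructure ι ρ f) :
    IsOpen (domainOmega f) ∧
    (∀ γ : Γ, ∀ x ∈ domainOmega f, ρ γ • x ∈ domainOmega f) ∧
    (∀ γ : Γ, ∀ x ∈ domainOmega f, ρ γ • x = x → IsOfFinOrder γ) ∧
    (∀ K K' : Set Flag, IsCompact K → IsCompact K' → K ⊆ domainOmega f → K' ⊆ domainOmega f →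
      {γ : Γ | (((fun x => ρ γ • x) '' K) ∩ K').Nonempty}.Finite) :=
  ⟨hf.isOpen_domainOmega hι hdisc, fun γ _ => hf.smul_mem_domainOmega γ,
    fun _ _ => hf.isOfFinOrder_of_smul_eq hι hdisc,
    fun _ _ => hf.finite_setOf_image_inter_nonempty hι hdisc⟩

open scoped MatrixGroups in
open AnosovFlag in
theorem mainTheorem1 {Γ : Type*} [Group Γ] (hΓ : IsHyperbolicSurfaceGroup Γ)
    (ι : Γ →* SL(2, ℝ)) (hι : Function.Injective ι) (hdisc : DiscreteTopology ι.range)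
    (ρ : Γ →* SL(3, ℝ)) (f : SL(2, ℝ) → Frame) (hf : IsAnosovStructure ι ρ f) :
    -- `Ω` is open and `ρ(Γ)`-invariant
    IsOpen (domainOmega f) ∧
    (∀ γ : Γ, ∀ x ∈ domainOmega f, ρ γ • x ∈ domainOmega f) ∧
    -- the action is free
    (∀ γ : Γ, ∀ x ∈ domainOmega f, ρ γ • x = x → γ = 1) ∧
    -- the action is properly discontinuous
    (∀ K K' : Set Flag, IsCompact K → IsCompact K' → K ⊆ domainOmega f → K' ⊆ domainOmega f →
      {γ : Γ | (((fun x => ρ γ • x) '' K) ∩ K').Nonempty}.Finite) := by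
  obtain ⟨hopen, hinv, hfree, hpd⟩ := mainTheorem1_general ι hι hdisc ρ f hf
  exact ⟨hopen, hinv, fun γ x hx h => hΓ.eq_one_of_isOfFinOrder (hfree γ x hx h), hpd⟩
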